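/- Let $k$ be an algebraically closed field of characteristic zero, let $m,n\ge 1$ be integers, and let $G=\mathbb{Z}_m\times\mathbb{Z}_n=\langle g_1\rangle\times\langle g_2\rangle$ (written multiplicatively). Let $(\operatorname{Vec}_G,\otimes)$ be the linear Gr-category over $G$: the category of finite-dimensional $G$-graded $k$-vector spaces and degree-preserving linear maps, with the tensor product $(V\otimes W)_g=\bigoplus_{xy=g}V_x\otimes W_y$. A monoidal structure on $(\operatorname{Vec}_G,\otimes)$ consists of a unit object and natural associativity and unit isomorphisms for $\otimes$ satisfying the pentagon and triangle axioms. For a normalized $3$-cocycle $\Phi:G^3\to k^*$ (trivial action), that is, a map with $\Phi(y,z,t)\Phi(x,yz,t)\Phi(x,y,z)=\Phi(xy,z,t)\Phi(x,y,zt)$ for all $x,y,z,t\in G$ and $\Phi(x,y,z)=1$ whenever one of $x,y,z$ is the identity, let $\operatorname{Vec}_G^{\Phi}$ be the monoidal structure whose unit is $k$ in the degree of the identity, whose unit isomorphisms are the usual ones, and whose associativity isomorphism is $(u\otimes v)\otimes w\mapsto \Phi(x,y,z)\,u\otimes(v\otimes w)$ for $u\in U_x$, $v\in V_y$, $w\in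 W_z$. Let $\zeta_m,\zeta_n\in k^*$ be primitive $m$-th and $n$-th roots of unity and, for integers $a,b,d\ge 0$, let $\Phi_{a,b,d}$ be the normalized $3$-cocycle $$\Phi_{a,b,d}(g_1^{i}g_2^{j},\,g_1^{s}g_2^{t},\,g_1^{e}g_2^{f})=\zeta_m^{\,a\,i\lfloor (s+e)/m\rfloor}\,\zeta_n^{\,b\,j\lfloor (s+e)/m\rfloor}\,\zeta_n^{\,d\,j\lfloor (t+f)/n\rfloor},\qquad 0\le i,s,e<m,\quad 0\le j,t,f<n.$$ Then every monoidal structure on $(\operatorname{Vec}_G,\otimes)$ is tensor equivalent (by a $k$-linear monoidal functor that is an equivalence of categories) to $\operatorname{Vec}_G^{\Phi_{a,b,d}}$ for some $0\le a<m$, $0\le b<\gcd(m,n)$, $0\le d<n$. -/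

import Mathlib

open CategoryTheory
open scoped TensorProduct

universe u w

/-- A finite-dimensional `G`-graded vector space over `k`: a finite-dimensional space `V`
with subspaces `V_g` (`g ∈ G`) such that `V` is their (internal) direct sum. -/
structure GrVec (k : Type u) [Field k] (G : Type w) [DecidableEq G] where
  carrier : Type u
  [addCommGroup : AddCommGroup carrier]
  [module : Module k carrier]
  [finiteDimensional : FiniteDimensional k carrier]
  deg : G → Submodule k carrier
  isInternal : DirectSum.IsInternal deg

namespace GrVec

attribute [instance] GrVec.addCommGroup GrVec.module GrVec.finiteDimensional

instance {k : Type u} [Field k] {G : Type w} [DecidableEq G] :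
    CoeSort (GrVec k G) (Type u) := ⟨GrVec.carrier⟩

section Category

variable {k : Type u} [Field k] {G : Type w} [DecidableEq G]

/-- Morphisms of graded spaces: the linear maps that preserve the grading. -/
@[ext]
structure Hom (V W : GrVec k G) where
  lin : V →ₗ[k] W
  map_deg : ∀ g : G, ∀ v ∈ V.deg g, lin v ∈ W.deg g

/-- The category `Vec_G` of finite-dimensional `G`-graded vector spaces. -/
instance : Category (GrVec k G) where
  Hom V W := Hom V W
  id V := ⟨LinearMap.id, fun _ _ h => h⟩
  comp f g := ⟨g.lin ∘ₗ f.lin, fun x v h => g.map_deg x _ (f.map_deg x v h)⟩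

@[ext]
theorem hom_ext {V W : GrVec k G} {f g : V ⟶ W} (h : Hom.lin f = Hom.lin g) : f = g :=
  Hom.ext h

@[simp]
theorem id_lin (V : GrVec k G) : Hom.lin (𝟙 V) = LinearMap.id := rfl

@[simp]
theorem comp_lin {U V W : GrVec k G} (f : U ⟶ V) (g : V ⟶ W) :
    Hom.lin (f ≫ g) = Hom.lin g ∘ₗ Hom.lin f := rfl

instance (V W : GrVec k G) : Zero (V ⟶ W) :=
  ⟨⟨0, fun g _ _ => (W.deg g).zero_mem⟩⟩

instance (V W : GrVec k G) : Add (V ⟶ W) :=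
  ⟨fun f g => ⟨f.lin + g.lin, fun x v h =>
    (W.deg x).add_mem (f.map_deg x v h) (g.map_deg x v h)⟩⟩

instance (V W : GrVec k G) : Neg (V ⟶ W) :=
  ⟨fun f => ⟨-f.lin, fun x v h => (W.deg x).neg_mem (f.map_deg x v h)⟩⟩

instance (V W : GrVec k G) : Sub (V ⟶ W) :=
  ⟨fun f g => ⟨f.lin - g.lin, fun x v h =>
    (W.deg x).sub_mem (f.map_deg x v h) (g.map_deg x v h)⟩⟩


instance (V W : GrVec k G) : SMul k (V ⟶ W) :=
  ⟨fun c f => ⟨c • f.lin, fun x v h => (W.deg x).smul_mem c (f.map_deg x v h)⟩⟩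

instance (V W : GrVec k G) : SMul ℕ (V ⟶ W) :=
  ⟨fun c f => ⟨c • f.lin, fun x v h => nsmul_mem (f.map_deg x v h) c⟩⟩

instance (V W : GrVec k G) : SMul ℤ (V ⟶ W) :=
  ⟨fun c f => ⟨c • f.lin, fun x v h => zsmul_mem (f.map_deg x v h) c⟩⟩

instance (V W : GrVec k G) : AddCommGroup (V ⟶ W) :=
  Function.Injective.addCommGroup (fun f : V ⟶ W => Hom.lin f) (fun _ _ h => hom_ext h)
    rfl (fun _ _ => rfl) (fun _ => rfl) (fun _ _ => rfl) (fun _ _ => rfl) (fun _ _ => rfl)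

/-- Taking the underlying linear map, as an additive map. -/
def linAddHom (V W : GrVec k G) : (V ⟶ W) →+ (V →ₗ[k] W) where
  toFun f := Hom.lin f
  map_zero' := rfl
  map_add' _ _ := rfl

instance (V W : GrVec k G) : Module k (V ⟶ W) :=
  Function.Injective.module k (linAddHom V W) (fun _ _ h => hom_ext h) (fun _ _ => rfl)

@[simp]
theorem add_lin {V W : GrVec k G} (f g : V ⟶ W) :
    Hom.lin (f + g) = Hom.lin f + Hom.lin g := rfl

@[simp]
theorem smul_lin {V W : GrVec k G} (c : k) (f : V ⟶ W) :
    Hom.lin (c • f) = c • Hom.lin f := rfl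

instance : Preadditive (GrVec k G) where
  homGroup _ _ := inferInstance
  add_comp _ _ _ f f' g := hom_ext (LinearMap.comp_add (Hom.lin f) (Hom.lin f') (Hom.lin g))
  comp_add _ _ _ f g g' := hom_ext (LinearMap.add_comp (Hom.lin f) (Hom.lin g') (Hom.lin g))

instance : Linear k (GrVec k G) where
  homModule V W := inferInstanceAs (Module k (V ⟶ W))
  smul_comp _ _ _ r f g := hom_ext (LinearMap.comp_smul (Hom.lin g) r (Hom.lin f))
  comp_smul _ _ _ f r g := hom_ext (LinearMap.smul_comp r (Hom.lin g) (Hom.lin f))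

end Category

section Projections

variable {k : Type u} [Field k] {G : Type w} [DecidableEq G]

/-- The projection of a graded space onto its component of degree `g`. -/
noncomputable def proj (V : GrVec k G) (g : G) : V →ₗ[k] V :=
  (V.deg g).subtype ∘ₗ DirectSum.component k G (fun i => V.deg i) g ∘ₗ
    (LinearEquiv.ofBijective (DirectSum.coeLinearMap V.deg) V.isInternal).symm.toLinearMap

theorem proj_mem (V : GrVec k G) (g : G) (v : V) : V.proj g v ∈ V.deg g :=
  Subtype.property _

theorem proj_of_mem (V : GrVec k G) {g : G} {v : V} (hv : v ∈ V.deg g) : V.proj g v = v :=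
  congrArg Subtype.val (V.isInternal.ofBijective_coeLinearMap_of_mem hv)

theorem proj_of_mem_ne (V : GrVec k G) {g h : G} (hgh : g ≠ h) {v : V} (hv : v ∈ V.deg g) :
    V.proj h v = 0 :=
  congrArg Subtype.val (V.isInternal.ofBijective_coeLinearMap_of_mem_ne hgh hv)

theorem iSup_deg (V : GrVec k G) : iSup V.deg = ⊤ := V.isInternal.submodule_iSup_eq_top

/-- Linear maps on a graded space that agree on homogeneous elements are equal. -/
theorem lin_ext (V : GrVec k G) {P : Type*} [AddCommMonoid P] [Module k P] {f f' : V →ₗ[k] P}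
    (h : ∀ g, ∀ v ∈ V.deg g, f v = f' v) : f = f' := by
  rw [← LinearMap.eqLocus_eq_top, eq_top_iff, ← V.iSup_deg]
  exact iSup_le fun g v hv => h g v hv

variable [Fintype G]

theorem sum_proj (V : GrVec k G) : ∑ g, V.proj g = LinearMap.id :=
  V.lin_ext fun g v hv => by
    rw [LinearMap.sum_apply, Finset.sum_eq_single g, proj_of_mem V hv, LinearMap.id_apply]
    · exact fun h _ hne => proj_of_mem_ne V hne.symm hv
    · exact fun h => absurd (Finset.mem_univ g) h

/-- Subspaces admitting a complete system of projections form a direct sum decomposition. -/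
theorem isInternal_of_proj {M : Type*} [AddCommGroup M] [Module k M] (A : G → Submodule k M)
    (p : G → M →ₗ[k] M) (hmem : ∀ g v, p g v ∈ A g) (hid : ∀ g, ∀ v ∈ A g, p g v = v)
    (hzero : ∀ g h, g ≠ h → ∀ v ∈ A g, p h v = 0) (hsum : ∀ v, ∑ g, p g v = v) :
    DirectSum.IsInternal A := by
  refine DirectSum.isInternal_submodule_of_iSupIndep_of_iSup_eq_top ?_ ?_
  · intro g
    rw [Submodule.disjoint_def]
    intro v hv hv'
    have hker : (⨆ j, ⨆ (_ : j ≠ g), A j) ≤ LinearMap.ker (p g) :=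
      iSup_le fun j => iSup_le fun hj w hw => hzero j g hj w hw
    rw [← hid g v hv]
    exact hker hv'
  · rw [eq_top_iff]
    intro v _
    rw [← hsum v]
    exact Submodule.sum_mem _ fun g _ => Submodule.mem_iSup_of_mem g (hmem g v)

end Projections

section Tensor

variable {k : Type u} [Field k] {G : Type w} [DecidableEq G] [AddGroup G]

/-- The component of degree `g` of the tensor product: the sum of the `V_x ⊗ W_y` over all
`x, y` with product `g` (the group is written additively). Here `Submodule.map₂` gives the
subspace of `V ⊗ W` spanned by the `v ⊗ w` with `v ∈ V_x` and `w ∈ W_y`. -/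
def tensorDeg (V W : GrVec k G) (g : G) : Submodule k (V ⊗[k] W) :=
  ⨆ (x : G) (y : G) (_ : x + y = g), Submodule.map₂ (TensorProduct.mk k V W) (V.deg x) (W.deg y)

theorem tmul_mem_tensorDeg {V W : GrVec k G} {x y : G} {v : V} {w : W} (hv : v ∈ V.deg x)
    (hw : w ∈ W.deg y) : v ⊗ₜ[k] w ∈ tensorDeg V W (x + y) :=
  Submodule.mem_iSup_of_mem x <| Submodule.mem_iSup_of_mem y <|
    Submodule.mem_iSup_of_mem rfl <| Submodule.apply_mem_map₂ (TensorProduct.mk k V W) hv hw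

theorem tensorDeg_le {V W : GrVec k G} {g : G} {S : Submodule k (V ⊗[k] W)} :
    tensorDeg V W g ≤ S ↔
      ∀ x y, x + y = g → ∀ v ∈ V.deg x, ∀ w ∈ W.deg y, v ⊗ₜ[k] w ∈ S := by
  simp only [tensorDeg, iSup_le_iff, Submodule.map₂_le, TensorProduct.mk_apply]

variable [Fintype G]

/-- The tensor product of graded spaces: `V ⊗ W` with
`(V ⊗ W)_g = ⨁_{x y = g} V_x ⊗ W_y`. -/
@[reducible]
noncomputable def tensorObj (V W : GrVec k G) : GrVec k G where
  carrier := V ⊗[k] W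
  deg := tensorDeg V W
  isInternal := by
    have key : ∀ g x y, ∀ v ∈ V.deg x, ∀ w ∈ W.deg y,
        (∑ z, TensorProduct.map (V.proj z) (W.proj (-z + g))) (v ⊗ₜ[k] w) =
          if x + y = g then v ⊗ₜ[k] w else 0 := by
      intro g x y v hv w hw
      rw [LinearMap.sum_apply, Finset.sum_eq_single x]
      · rw [TensorProduct.map_tmul, proj_of_mem V hv]
        split_ifs with h
        · rw [← h, neg_add_cancel_left, proj_of_mem W hw]
        · rw [proj_of_mem_ne W _ hw, TensorProduct.tmul_zero]
          intro h'
          exact h (by rw [h', add_neg_cancel_left])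
      · intro z _ hz
        rw [TensorProduct.map_tmul, proj_of_mem_ne V hz.symm hv, TensorProduct.zero_tmul]
      · exact fun h => absurd (Finset.mem_univ x) h
    refine isInternal_of_proj _
      (fun g => ∑ z, TensorProduct.map (V.proj z) (W.proj (-z + g))) ?_ ?_ ?_ ?_
    · intro g t
      induction t with
      | zero => rw [map_zero]; exact Submodule.zero_mem _
      | add a b ha hb => rw [map_add]; exact Submodule.add_mem _ ha hb
      | tmul v w =>
        rw [LinearMap.sum_apply]
        refine Submodule.sum_mem _ fun z _ => ?_
        have := tmul_mem_tensorDeg (V.proj_mem z v) (W.proj_mem (-z + g) w)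
        rwa [add_neg_cancel_left] at this
    · intro g t ht
      have : tensorDeg V W g ≤ LinearMap.eqLocus
          (∑ z, TensorProduct.map (V.proj z) (W.proj (-z + g))) LinearMap.id :=
        tensorDeg_le.2 fun x y h v hv w hw => by
          rw [LinearMap.mem_eqLocus, key g x y v hv w hw, if_pos h, LinearMap.id_apply]
      exact this ht
    · intro g h hgh t ht
      have : tensorDeg V W g ≤ LinearMap.ker
          (∑ z, TensorProduct.map (V.proj z) (W.proj (-z + h))) :=
        tensorDeg_le.2 fun x y hxy v hv w hw => by
          rw [LinearMap.mem_ker, key h x y v hv w hw, if_neg]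
          rw [hxy]; exact hgh
      exact this ht
    · intro t
      have : (∑ g, ∑ z, TensorProduct.map (V.proj z) (W.proj (-z + g))) =
          (LinearMap.id : V ⊗[k] W →ₗ[k] V ⊗[k] W) := by
        refine TensorProduct.ext (V.lin_ext fun x v hv => W.lin_ext fun y w hw => ?_)
        change (∑ g, ∑ z, TensorProduct.map (V.proj z) (W.proj (-z + g))) (v ⊗ₜ[k] w) = v ⊗ₜ[k] w
        rw [LinearMap.sum_apply, Finset.sum_congr rfl fun g _ => key g x y v hv w hw,
          Finset.sum_ite_eq, if_pos (Finset.mem_univ _)]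
      rw [← LinearMap.sum_apply, this, LinearMap.id_apply]

theorem deg_tensorObj (V W : GrVec k G) (g : G) : (tensorObj V W).deg g = tensorDeg V W g := rfl

/-- The tensor product `f ⊗ g` of morphisms. -/
noncomputable def tensorHom {V V' W W' : GrVec k G} (f : V ⟶ V') (f' : W ⟶ W') :
    tensorObj V W ⟶ tensorObj V' W' where
  lin := TensorProduct.map (Hom.lin f) (Hom.lin f')
  map_deg g t ht := by
    have : tensorDeg V W g ≤
        (tensorDeg V' W' g).comap (TensorProduct.map (Hom.lin f) (Hom.lin f')) :=
      tensorDeg_le.2 fun x y h v hv w hw => by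
        subst h
        exact tmul_mem_tensorDeg (Hom.map_deg f x v hv) (Hom.map_deg f' y w hw)
    exact this ht

@[simp]
theorem tensorHom_lin {V V' W W' : GrVec k G} (f : V ⟶ V') (f' : W ⟶ W') :
    Hom.lin (tensorHom f f') = TensorProduct.map (Hom.lin f) (Hom.lin f') := rfl

theorem tensorHom_id_id (V W : GrVec k G) : tensorHom (𝟙 V) (𝟙 W) = 𝟙 (tensorObj V W) :=
  hom_ext TensorProduct.map_id

theorem tensorHom_comp {V V' V'' W W' W'' : GrVec k G} (f : V ⟶ V') (g : W ⟶ W')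
    (f' : V' ⟶ V'') (g' : W' ⟶ W'') :
    tensorHom f g ≫ tensorHom f' g' = tensorHom (f ≫ f') (g ≫ g') :=
  hom_ext (TensorProduct.map_comp (Hom.lin f') (Hom.lin g') (Hom.lin f) (Hom.lin g)).symm

end Tensor

section Unit

variable (k : Type u) [Field k] (G : Type w) [DecidableEq G] [AddGroup G]

/-- The graded space `k`, concentrated in the degree of the neutral element. -/
@[reducible]
def unitObj : GrVec k G where
  carrier := k
  deg g := if g = 0 then ⊤ else ⊥
  isInternal := by
    refine DirectSum.isInternal_submodule_of_iSupIndep_of_iSup_eq_top ?_ ?_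
    · intro g
      by_cases hg : g = 0
      · have : (⨆ j, ⨆ (_ : j ≠ g), if j = 0 then (⊤ : Submodule k k) else ⊥) = ⊥ :=
          iSup_eq_bot.2 fun j => iSup_eq_bot.2 fun hj => if_neg fun h => hj (h.trans hg.symm)
        rw [this]
        exact disjoint_bot_right
      · change Disjoint (if g = 0 then (⊤ : Submodule k k) else ⊥) _
        rw [if_neg hg]
        exact disjoint_bot_left
    · rw [eq_top_iff]
      exact le_iSup_of_le (0 : G) (by rw [if_pos rfl])

variable {k G}

theorem deg_unitObj (g : G) : (unitObj k G).deg g = if g = 0 then ⊤ else ⊥ := rfl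

theorem mem_deg_unitObj {g : G} {c : k} (hc : c ∈ (unitObj k G).deg g) : g = 0 ∨ c = 0 := by
  by_cases hg : g = 0
  · exact Or.inl hg
  · rw [deg_unitObj, if_neg hg] at hc
    exact Or.inr ((Submodule.mem_bot k).1 hc)

theorem one_mem_deg_unitObj : (1 : k) ∈ (unitObj k G).deg 0 := by
  rw [deg_unitObj, if_pos rfl]
  exact Submodule.mem_top

variable [Fintype G]

/-- The canonical isomorphism `k ⊗ V ≅ V`, `c ⊗ v ↦ c v`. -/
noncomputable def lidIso (V : GrVec k G) : tensorObj (unitObj k G) V ≅ V where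
  hom := ⟨(TensorProduct.lid k V).toLinearMap, fun g t ht => by
    have : tensorDeg (unitObj k G) V g ≤
        (V.deg g).comap (TensorProduct.lid k V).toLinearMap :=
      tensorDeg_le.2 fun x y h c hc v hv => by
        rcases mem_deg_unitObj hc with hx | hx
        · subst hx
          rw [zero_add] at h
          subst h
          exact (V.deg y).smul_mem c hv
        · subst hx
          rw [Submodule.mem_comap, TensorProduct.zero_tmul, map_zero]
          exact Submodule.zero_mem _
    exact this ht⟩
  inv := ⟨(TensorProduct.lid k V).symm.toLinearMap, fun g v hv => by
    have := tmul_mem_tensorDeg (one_mem_deg_unitObj (k := k) (G := G)) hv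
    rw [zero_add] at this
    exact this⟩
  hom_inv_id := hom_ext (TensorProduct.lid k V).symm_comp
  inv_hom_id := hom_ext (TensorProduct.lid k V).comp_symm

/-- The canonical isomorphism `V ⊗ k ≅ V`, `v ⊗ c ↦ c v`. -/
noncomputable def ridIso (V : GrVec k G) : tensorObj V (unitObj k G) ≅ V where
  hom := ⟨(TensorProduct.rid k V).toLinearMap, fun g t ht => by
    have : tensorDeg V (unitObj k G) g ≤
        (V.deg g).comap (TensorProduct.rid k V).toLinearMap :=
      tensorDeg_le.2 fun x y h v hv c hc => by
        rcases mem_deg_unitObj hc with hy | hy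
        · subst hy
          rw [add_zero] at h
          subst h
          exact (V.deg x).smul_mem c hv
        · subst hy
          rw [Submodule.mem_comap, TensorProduct.tmul_zero, map_zero]
          exact Submodule.zero_mem _
    exact this ht⟩
  inv := ⟨(TensorProduct.rid k V).symm.toLinearMap, fun g v hv => by
    have := tmul_mem_tensorDeg hv (one_mem_deg_unitObj (k := k) (G := G))
    rw [add_zero] at this
    exact this⟩
  hom_inv_id := hom_ext (TensorProduct.rid k V).symm_comp
  inv_hom_id := hom_ext (TensorProduct.rid k V).comp_symm

theorem lidIso_tmul (V : GrVec k G) (c : k) (v : V) :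
    Hom.lin (lidIso V).hom (c ⊗ₜ[k] v) = c • v := rfl

theorem ridIso_tmul (V : GrVec k G) (c : k) (v : V) :
    Hom.lin (ridIso V).hom (v ⊗ₜ[k] c) = c • v := rfl

end Unit

section Twist

variable {k : Type u} [Field k] {G : Type w} [DecidableEq G]

/-- Morphisms out of `U ⊗ V` are determined on homogeneous pure tensors. -/
theorem tensor_ext {U V : GrVec k G} {P : Type*} [AddCommMonoid P] [Module k P]
    {f f' : U ⊗[k] V →ₗ[k] P}
    (h : ∀ x, ∀ a ∈ U.deg x, ∀ y, ∀ b ∈ V.deg y, f (a ⊗ₜ[k] b) = f' (a ⊗ₜ[k] b)) : f = f' :=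
  TensorProduct.ext (U.lin_ext fun x a ha => V.lin_ext fun y b hb => h x a ha y b hb)

/-- Morphisms out of `(U ⊗ V) ⊗ W` are determined on homogeneous pure tensors. -/
theorem tensor_ext₃ {U V W : GrVec k G} {P : Type*} [AddCommMonoid P] [Module k P]
    {f f' : (U ⊗[k] V) ⊗[k] W →ₗ[k] P}
    (h : ∀ x, ∀ a ∈ U.deg x, ∀ y, ∀ b ∈ V.deg y, ∀ z, ∀ c ∈ W.deg z,
      f ((a ⊗ₜ[k] b) ⊗ₜ[k] c) = f' ((a ⊗ₜ[k] b) ⊗ₜ[k] c)) : f = f' :=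
  TensorProduct.ext (tensor_ext fun x a ha y b hb => W.lin_ext fun z c hc =>
    h x a ha y b hb z c hc)

/-- Morphisms out of `((T ⊗ U) ⊗ V) ⊗ W` are determined on homogeneous pure tensors. -/
theorem tensor_ext₄ {T U V W : GrVec k G} {P : Type*} [AddCommMonoid P] [Module k P]
    {f f' : ((T ⊗[k] U) ⊗[k] V) ⊗[k] W →ₗ[k] P}
    (h : ∀ t, ∀ d ∈ T.deg t, ∀ x, ∀ a ∈ U.deg x, ∀ y, ∀ b ∈ V.deg y, ∀ z, ∀ c ∈ W.deg z,
      f (((d ⊗ₜ[k] a) ⊗ₜ[k] b) ⊗ₜ[k] c) = f' (((d ⊗ₜ[k] a) ⊗ₜ[k] b) ⊗ₜ[k] c)) : f = f' :=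
  TensorProduct.ext (tensor_ext₃ fun t d hd x a ha y b hb => W.lin_ext fun z c hc =>
    h t d hd x a ha y b hb z c hc)

variable [Fintype G]

/-- Multiplication of the summand `(U_x ⊗ V_y) ⊗ W_z` of `(U ⊗ V) ⊗ W` by the scalar
`φ(x, y, z)`. -/
noncomputable def twist (φ : G → G → G → kˣ) (U V W : GrVec k G) :
    (U ⊗[k] V) ⊗[k] W →ₗ[k] (U ⊗[k] V) ⊗[k] W :=
  ∑ x, ∑ y, ∑ z, (φ x y z : k) •
    TensorProduct.map (TensorProduct.map (U.proj x) (V.proj y)) (W.proj z)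

theorem twist_tmul (φ : G → G → G → kˣ) {U V W : GrVec k G} {x y z : G} {a : U} {b : V} {c : W}
    (ha : a ∈ U.deg x) (hb : b ∈ V.deg y) (hc : c ∈ W.deg z) :
    twist φ U V W ((a ⊗ₜ[k] b) ⊗ₜ[k] c) = (φ x y z : k) • ((a ⊗ₜ[k] b) ⊗ₜ[k] c) := by
  simp only [twist, LinearMap.sum_apply, LinearMap.smul_apply, TensorProduct.map_tmul]
  rw [Finset.sum_eq_single x, Finset.sum_eq_single y, Finset.sum_eq_single z,
    proj_of_mem U ha, proj_of_mem V hb, proj_of_mem W hc]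
  · intro z' _ hz
    rw [proj_of_mem_ne W hz.symm hc, TensorProduct.tmul_zero, smul_zero]
  · exact fun h => absurd (Finset.mem_univ z) h
  · intro y' _ hy
    refine Finset.sum_eq_zero fun z' _ => ?_
    rw [proj_of_mem_ne V hy.symm hb, TensorProduct.tmul_zero, TensorProduct.zero_tmul, smul_zero]
  · exact fun h => absurd (Finset.mem_univ y) h
  · intro x' _ hx
    refine Finset.sum_eq_zero fun y' _ => Finset.sum_eq_zero fun z' _ => ?_
    rw [proj_of_mem_ne U hx.symm ha, TensorProduct.zero_tmul, TensorProduct.zero_tmul, smul_zero]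
  · exact fun h => absurd (Finset.mem_univ x) h

variable [AddGroup G]

/-- The associativity isomorphism `(U ⊗ V) ⊗ W ≅ U ⊗ (V ⊗ W)` twisted by `φ`: it sends
`(a ⊗ b) ⊗ c` to `φ(x, y, z) a ⊗ (b ⊗ c)` if `a`, `b`, `c` have degrees `x`, `y`, `z`. -/
noncomputable def assocIso (φ : G → G → G → kˣ) (U V W : GrVec k G) :
    tensorObj (tensorObj U V) W ≅ tensorObj U (tensorObj V W) where
  hom := ⟨(TensorProduct.assoc k U V W).toLinearMap ∘ₗ twist φ U V W, fun g t ht => by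
    have : tensorDeg (tensorObj U V) W g ≤ (tensorDeg U (tensorObj V W) g).comap
        ((TensorProduct.assoc k U V W).toLinearMap ∘ₗ twist φ U V W) :=
      tensorDeg_le.2 fun s z h r hr c hc => by
        have : tensorDeg U V s ≤ ((tensorDeg U (tensorObj V W) g).comap
            ((TensorProduct.assoc k U V W).toLinearMap ∘ₗ twist φ U V W)).comap
              ((TensorProduct.mk k (U ⊗[k] V) W).flip c) :=
          tensorDeg_le.2 fun x y hxy a ha b hb => by
            rw [Submodule.mem_comap, Submodule.mem_comap, LinearMap.flip_apply,
              TensorProduct.mk_apply, LinearMap.comp_apply, twist_tmul φ ha hb hc, map_smul]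
            refine Submodule.smul_mem _ _ ?_
            rw [← h, ← hxy, add_assoc]
            exact tmul_mem_tensorDeg (W := tensorObj V W) ha (tmul_mem_tensorDeg hb hc)
        exact this hr
    exact this ht⟩
  inv := ⟨twist (fun x y z => (φ x y z)⁻¹) U V W ∘ₗ
      (TensorProduct.assoc k U V W).symm.toLinearMap, fun g t ht => by
    have : tensorDeg U (tensorObj V W) g ≤ (tensorDeg (tensorObj U V) W g).comap
        (twist (fun x y z => (φ x y z)⁻¹) U V W ∘ₗ
          (TensorProduct.assoc k U V W).symm.toLinearMap) :=
      tensorDeg_le.2 fun x s h a ha r hr => by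
        have : tensorDeg V W s ≤ ((tensorDeg (tensorObj U V) W g).comap
            (twist (fun x y z => (φ x y z)⁻¹) U V W ∘ₗ
              (TensorProduct.assoc k U V W).symm.toLinearMap)).comap
                (TensorProduct.mk k U (V ⊗[k] W) a) :=
          tensorDeg_le.2 fun y z hyz b hb c hc => by
            rw [Submodule.mem_comap, Submodule.mem_comap, TensorProduct.mk_apply,
              LinearMap.comp_apply, LinearEquiv.coe_coe, TensorProduct.assoc_symm_tmul,
              twist_tmul _ ha hb hc]
            refine Submodule.smul_mem _ _ ?_
            rw [← h, ← hyz, ← add_assoc]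
            exact tmul_mem_tensorDeg (V := tensorObj U V) (tmul_mem_tensorDeg ha hb) hc
        exact this hr
    exact this ht⟩
  hom_inv_id := hom_ext <| tensor_ext₃ fun x a ha y b hb z c hc => by
    change twist (fun x y z => (φ x y z)⁻¹) U V W ((TensorProduct.assoc k U V W).symm
      (TensorProduct.assoc k U V W (twist φ U V W ((a ⊗ₜ[k] b) ⊗ₜ[k] c)))) = _
    rw [LinearEquiv.symm_apply_apply, twist_tmul φ ha hb hc, map_smul, twist_tmul _ ha hb hc,
      smul_smul, Units.mul_inv, one_smul]
    rfl
  inv_hom_id := hom_ext <| by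
    have h : twist φ U V W ∘ₗ twist (fun x y z => (φ x y z)⁻¹) U V W = LinearMap.id :=
      tensor_ext₃ fun x a ha y b hb z c hc => by
        rw [LinearMap.comp_apply, twist_tmul _ ha hb hc, map_smul, twist_tmul φ ha hb hc,
          smul_smul, Units.inv_mul, one_smul, LinearMap.id_apply]
    refine LinearMap.ext fun t => ?_
    change TensorProduct.assoc k U V W ((twist φ U V W ∘ₗ
      twist (fun x y z => (φ x y z)⁻¹) U V W) ((TensorProduct.assoc k U V W).symm t)) = t
    rw [h, LinearMap.id_apply, LinearEquiv.apply_symm_apply]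

theorem assocIso_hom_tmul (φ : G → G → G → kˣ) {U V W : GrVec k G} {x y z : G}
    {a : U} {b : V} {c : W} (ha : a ∈ U.deg x) (hb : b ∈ V.deg y) (hc : c ∈ W.deg z) :
    Hom.lin (assocIso φ U V W).hom ((a ⊗ₜ[k] b) ⊗ₜ[k] c) =
      (φ x y z : k) • (a ⊗ₜ[k] (b ⊗ₜ[k] c)) := by
  change TensorProduct.assoc k U V W (twist φ U V W ((a ⊗ₜ[k] b) ⊗ₜ[k] c)) = _
  rw [twist_tmul φ ha hb hc, map_smul, TensorProduct.assoc_tmul]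

end Twist

section MonoidalStructures

/-- A monoidal structure on the linear Gr-category `(Vec_G, ⊗)`: a unit object together with
natural associativity and unit isomorphisms that satisfy the pentagon and triangle axioms. -/
structure MonoidalStructure (k : Type u) [Field k] (G : Type w) [DecidableEq G] [AddGroup G]
    [Fintype G] where
  unit : GrVec k G
  assoc : ∀ U V W : GrVec k G, tensorObj (tensorObj U V) W ≅ tensorObj U (tensorObj V W)
  leftUnitor : ∀ V : GrVec k G, tensorObj unit V ≅ V
  rightUnitor : ∀ V : GrVec k G, tensorObj V unit ≅ V
  assoc_naturality : ∀ {U U' V V' W W' : GrVec k G} (f : U ⟶ U') (g : V ⟶ V') (h : W ⟶ W'),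
    tensorHom (tensorHom f g) h ≫ (assoc U' V' W').hom =
      (assoc U V W).hom ≫ tensorHom f (tensorHom g h)
  leftUnitor_naturality : ∀ {V V' : GrVec k G} (f : V ⟶ V'),
    tensorHom (𝟙 unit) f ≫ (leftUnitor V').hom = (leftUnitor V).hom ≫ f
  rightUnitor_naturality : ∀ {V V' : GrVec k G} (f : V ⟶ V'),
    tensorHom f (𝟙 unit) ≫ (rightUnitor V').hom = (rightUnitor V).hom ≫ f
  pentagon : ∀ T U V W : GrVec k G,
    tensorHom (assoc T U V).hom (𝟙 W) ≫ (assoc T (tensorObj U V) W).hom ≫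
        tensorHom (𝟙 T) (assoc U V W).hom =
      (assoc (tensorObj T U) V W).hom ≫ (assoc T U (tensorObj V W)).hom
  triangle : ∀ U V : GrVec k G,
    (assoc U unit V).hom ≫ tensorHom (𝟙 U) (leftUnitor V).hom =
      tensorHom (rightUnitor U).hom (𝟙 V)

variable {k : Type u} [Field k] {G : Type w} [DecidableEq G] [AddGroup G] [Fintype G]

/-- The category `Vec_G`, regarded as the monoidal category with tensor product `⊗` and with
the unit and the constraints of `S`. -/
def MonoidalStructure.Cat (_S : MonoidalStructure k G) : Type (max (u + 1) w) := GrVec k G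

namespace MonoidalStructure

variable (S : MonoidalStructure k G)

instance : Category S.Cat := inferInstanceAs (Category (GrVec k G))

instance : Preadditive S.Cat := inferInstanceAs (Preadditive (GrVec k G))

instance : Linear k S.Cat := inferInstanceAs (Linear k (GrVec k G))

noncomputable instance : MonoidalCategoryStruct S.Cat where
  tensorObj V W := (tensorObj V W : GrVec k G)
  whiskerLeft V _ _ f := tensorHom (𝟙 (V : GrVec k G)) f
  whiskerRight f W := tensorHom f (𝟙 (W : GrVec k G))
  tensorHom f g := tensorHom f g
  tensorUnit := S.unit
  associator := S.assoc
  leftUnitor := S.leftUnitor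
  rightUnitor := S.rightUnitor

noncomputable instance : MonoidalCategory S.Cat :=
  MonoidalCategory.ofTensorHom
    (id_tensorHom_id := fun V W => tensorHom_id_id (k := k) (G := G) V W)
    (id_tensorHom := fun _ _ _ _ => rfl)
    (tensorHom_id := fun _ _ => rfl)
    (tensorHom_comp_tensorHom := fun f₁ f₂ g₁ g₂ => tensorHom_comp f₁ f₂ g₁ g₂)
    (associator_naturality := fun f g h => S.assoc_naturality f g h)
    (leftUnitor_naturality := fun f => S.leftUnitor_naturality f)
    (rightUnitor_naturality := fun f => S.rightUnitor_naturality f)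
    (pentagon := S.pentagon)
    (triangle := S.triangle)

/-- Tensor equivalence: there is a `k`-linear monoidal functor that is an equivalence of
categories. -/
def TensorEquivalent (S S' : MonoidalStructure k G) : Prop :=
  ∃ F : S.Cat ⥤ S'.Cat, F.IsEquivalence ∧ F.Additive ∧ F.Linear k ∧ Nonempty F.Monoidal

end MonoidalStructure

end MonoidalStructures

end GrVec

/-- A normalized `3`-cocycle on `G` (written additively) with values in the abelian group `A`
(written multiplicatively) with trivial action. -/
structure NormalizedCocycle₃ (G : Type*) [AddGroup G] (A : Type*) [CommGroup A] where
  toFun : G → G → G → A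
  cocycle : ∀ x y z t, toFun y z t * toFun x (y + z) t * toFun x y z =
    toFun (x + y) z t * toFun x y (z + t)
  map_zero_left : ∀ y z, toFun 0 y z = 1
  map_zero_mid : ∀ x z, toFun x 0 z = 1
  map_zero_right : ∀ x y, toFun x y 0 = 1

namespace GrVec

variable {k : Type u} [Field k] {G : Type w} [DecidableEq G] [AddGroup G] [Fintype G]

/-- The monoidal category `Vec_G^Φ`: the associativity constraint is the usual one multiplied by
`Φ(x, y, z)` on `(U_x ⊗ V_y) ⊗ W_z`, and the unit constraints are the usual ones. -/
noncomputable def ofCocycle (Φ : NormalizedCocycle₃ G kˣ) : MonoidalStructure k G where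
  unit := unitObj k G
  assoc := assocIso Φ.toFun
  leftUnitor := lidIso
  rightUnitor := ridIso
  assoc_naturality {U U' V V' W W'} f g h := hom_ext <|
    tensor_ext₃ fun x a ha y b hb z c hc => by
      change Hom.lin (assocIso Φ.toFun U' V' W').hom
          ((Hom.lin f a ⊗ₜ[k] Hom.lin g b) ⊗ₜ[k] Hom.lin h c) =
        TensorProduct.map (Hom.lin f) (TensorProduct.map (Hom.lin g) (Hom.lin h))
          (Hom.lin (assocIso Φ.toFun U V W).hom ((a ⊗ₜ[k] b) ⊗ₜ[k] c))
      rw [assocIso_hom_tmul _ (Hom.map_deg f x a ha) (Hom.map_deg g y b hb)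
        (Hom.map_deg h z c hc), assocIso_hom_tmul _ ha hb hc, map_smul]
      rfl
  leftUnitor_naturality {V V'} f := hom_ext <| TensorProduct.ext' fun c v =>
    (map_smul (Hom.lin f) c v).symm
  rightUnitor_naturality {V V'} f := hom_ext <| TensorProduct.ext' fun v c =>
    (map_smul (Hom.lin f) c v).symm
  pentagon T U V W := hom_ext <| tensor_ext₄ fun t d hd x a ha y b hb z c hc => by
    have h1 : Hom.lin (tensorHom (assocIso Φ.toFun T U V).hom (𝟙 W))
        (((d ⊗ₜ[k] a) ⊗ₜ[k] b) ⊗ₜ[k] c) =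
        (Φ.toFun t x y : k) • ((d ⊗ₜ[k] (a ⊗ₜ[k] b)) ⊗ₜ[k] c) := by
      rw [tensorHom_lin, TensorProduct.map_tmul, assocIso_hom_tmul _ hd ha hb]
      rfl
    have h2 := assocIso_hom_tmul Φ.toFun (V := tensorObj U V) hd (tmul_mem_tensorDeg ha hb) hc
    have h3 : Hom.lin (tensorHom (𝟙 T) (assocIso Φ.toFun U V W).hom)
        (d ⊗ₜ[k] ((a ⊗ₜ[k] b) ⊗ₜ[k] c)) =
        (Φ.toFun x y z : k) • (d ⊗ₜ[k] (a ⊗ₜ[k] (b ⊗ₜ[k] c))) := by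
      rw [tensorHom_lin, TensorProduct.map_tmul, assocIso_hom_tmul _ ha hb hc,
        TensorProduct.tmul_smul]
      rfl
    have h4 := assocIso_hom_tmul Φ.toFun (U := tensorObj T U) (tmul_mem_tensorDeg hd ha) hb hc
    have h5 := assocIso_hom_tmul Φ.toFun (W := tensorObj V W) hd ha (tmul_mem_tensorDeg hb hc)
    have hΦ := congrArg (Units.val : kˣ → k) (Φ.cocycle t x y z)
    rw [Units.val_mul, Units.val_mul, Units.val_mul] at hΦ
    simp only [comp_lin, LinearMap.comp_apply]
    rw [h1, map_smul, map_smul, h2, map_smul, h3, h4, map_smul, h5, smul_smul, smul_smul,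
      smul_smul, ← hΦ]
    congr 1
    ring
  triangle U V := hom_ext <| tensor_ext₃ fun x a ha y c hc z v hv => by
    rcases mem_deg_unitObj hc with hy | hy
    · subst hy
      simp only [comp_lin, LinearMap.comp_apply]
      rw [assocIso_hom_tmul _ ha hc hv, Φ.map_zero_mid, Units.val_one, one_smul, tensorHom_lin,
        tensorHom_lin, TensorProduct.map_tmul, TensorProduct.map_tmul, lidIso_tmul, ridIso_tmul]
      exact TensorProduct.tmul_smul c a v
    · subst hy
      rw [TensorProduct.tmul_zero, TensorProduct.zero_tmul, map_zero, map_zero]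

end GrVec

theorem zmod_carry {m : ℕ} [NeZero m] (y z t : ZMod m) :
    (t.val + (y + z).val) / m + (z.val + y.val) / m =
      (t.val + z.val) / m + ((z + t).val + y.val) / m := by
  have hm : 0 < m := Nat.pos_of_ne_zero (NeZero.ne m)
  have key : ∀ p q : ℕ, (q + p % m) / m + p / m = (q + p) / m := by
    intro p q
    conv_rhs => rw [← Nat.mod_add_div p m, ← add_assoc, Nat.add_mul_div_left _ _ hm]
  rw [ZMod.val_add, ZMod.val_add, add_comm z.val y.val, key, add_comm _ y.val,
    add_comm (_ / m) (_ / m), add_comm t.val z.val, key]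
  congr 1
  ring

theorem pow_mul_zmod_val_add {A : Type*} [CommGroup A] {m : ℕ} [NeZero m] {ζ : A}
    (hζ : ζ ^ m = 1) (e : ℕ) (x y : ZMod m) :
    ζ ^ (e * (x + y).val) = ζ ^ (e * (x.val + y.val)) := by
  rw [mul_comm e, mul_comm e, pow_mul, pow_mul, ZMod.val_add,
    ← pow_eq_pow_mod (x.val + y.val) hζ]

/-- The normalized `3`-cocycle
`Φ(g₁^i g₂^j, g₁^s g₂^t, g₁^e g₂^f) = ζ_m^{a i [(s+e)/m]} ζ_n^{b j [(s+e)/m]} ζ_n^{d j [(t+f)/n]}`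
of `ℤ_m × ℤ_n`, where the exponents of `g₁` and of `g₂` are taken in `{0, …, m - 1}` and in
`{0, …, n - 1}` and `[q]` is the integral part of `q`. -/
def cocycleABD {A : Type*} [CommGroup A] (m n : ℕ) [NeZero m] [NeZero n] (ζm ζn : A)
    (hζm : ζm ^ m = 1) (hζn : ζn ^ n = 1) (a b d : ℕ) :
    NormalizedCocycle₃ (ZMod m × ZMod n) A where
  toFun x y z :=
    ζm ^ (a * ((z.1.val + y.1.val) / m) * x.1.val) *
    ζn ^ (b * ((z.1.val + y.1.val) / m) * x.2.val) *
    ζn ^ (d * ((y.2.val + z.2.val) / n) * x.2.val)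
  cocycle x y z t := by
    have h1 := zmod_carry y.1 z.1 t.1
    have h2 := zmod_carry y.2 z.2 t.2
    simp only [Prod.fst_add, Prod.snd_add, pow_mul_zmod_val_add hζm, pow_mul_zmod_val_add hζn]
    generalize (t.1.val + (y.1 + z.1).val) / m = p₁ at *
    generalize (z.1.val + y.1.val) / m = p₂ at *
    generalize (t.1.val + z.1.val) / m = p₃ at *
    generalize ((z.1 + t.1).val + y.1.val) / m = p₄ at *
    have e1 : ζm ^ (a * p₁ * x.1.val) * ζm ^ (a * p₂ * x.1.val) =
        ζm ^ (a * p₃ * x.1.val) * ζm ^ (a * p₄ * x.1.val) := by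
      rw [← pow_add, ← pow_add, ← add_mul, ← add_mul, ← mul_add, ← mul_add, h1]
    have e2 : ζn ^ (b * p₁ * x.2.val) * ζn ^ (b * p₂ * x.2.val) =
        ζn ^ (b * p₃ * x.2.val) * ζn ^ (b * p₄ * x.2.val) := by
      rw [← pow_add, ← pow_add, ← add_mul, ← add_mul, ← mul_add, ← mul_add, h1]
    have e3 : ζn ^ (d * (((y.2 + z.2).val + t.2.val) / n) * x.2.val) *
        ζn ^ (d * ((y.2.val + z.2.val) / n) * x.2.val) =
        ζn ^ (d * ((z.2.val + t.2.val) / n) * x.2.val) *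
        ζn ^ (d * ((y.2.val + (z.2 + t.2).val) / n) * x.2.val) := by
      rw [add_comm _ t.2.val, add_comm y.2.val z.2.val, add_comm z.2.val t.2.val,
        add_comm y.2.val _, ← pow_add, ← pow_add, ← add_mul, ← add_mul, ← mul_add, ← mul_add, h2]
    simp only [mul_add, pow_add]
    generalize ζm ^ (a * p₁ * x.1.val) = A₁ at *
    generalize ζm ^ (a * p₂ * x.1.val) = A₂ at *
    generalize ζm ^ (a * p₃ * x.1.val) = A₃ at *
    generalize ζm ^ (a * p₄ * x.1.val) = A₄ at *
    generalize ζn ^ (b * p₁ * x.2.val) = B₁ at *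
    generalize ζn ^ (b * p₂ * x.2.val) = B₂ at *
    generalize ζn ^ (b * p₃ * x.2.val) = B₃ at *
    generalize ζn ^ (b * p₄ * x.2.val) = B₄ at *
    generalize ζn ^ (d * (((y.2 + z.2).val + t.2.val) / n) * x.2.val) = D₁ at *
    generalize ζn ^ (d * ((y.2.val + z.2.val) / n) * x.2.val) = D₂ at *
    generalize ζn ^ (d * ((z.2.val + t.2.val) / n) * x.2.val) = D₃ at *
    generalize ζn ^ (d * ((y.2.val + (z.2 + t.2).val) / n) * x.2.val) = D₄ at *
    generalize ζm ^ (a * p₃ * y.1.val) = Y₁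
    generalize ζn ^ (b * p₃ * y.2.val) = Y₂
    generalize ζn ^ (d * ((z.2.val + t.2.val) / n) * y.2.val) = Y₃
    calc _ = (Y₁ * Y₂ * Y₃) * ((A₁ * A₂) * (B₁ * B₂) * (D₁ * D₂)) := by ac_rfl
      _ = _ := by
            rw [e1, e2, e3]
            ac_rfl
  map_zero_left y z := by simp
  map_zero_mid x z := by
    simp [Nat.div_eq_of_lt (ZMod.val_lt _)]
  map_zero_right x y := by
    simp [Nat.div_eq_of_lt (ZMod.val_lt _)]

/-! Since the tensor product is fixed, naturality against one-dimensional spaces turns a monoidal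
structure into scalars: the associator multiplies `U_x ⊗ V_y ⊗ W_z` by some `φ(x, y, z)`, and the
pentagon says that `φ` is a 3-cocycle (`exists_assoc_tmul`, `assoc_cocycle`). If `φ` differs from a
normalized cocycle `Ψ` by the coboundary of `h`, the identity functor with tensorator `h` is a
monoidal equivalence to `Vec_G^Ψ`; the unit object is a line in degree `0`, and by the triangle
axiom one rescaling repairs both unit constraints (`tensorEquivalent_ofCocycle`). It remains to find
representatives of all classes in `H³(ℤ_m × ℤ_n, k*)`, which is `exists_cocycleABD`.

For this, `Ψ(·, y, z)` is read as a 2-cocycle with values in the functions `G → A` modulo constants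
(dimension shifting), which defines the extension `CocycleExt`. Divisibility of `A` allows the two
generators to be lifted to commuting elements `X`, `Y` (`CocycleExt.exists_commute`). The products
`X^i Y^j` are then additive in `(i, j)`, and all that keeps them from descending to `G` is `X^m` and
`Y^n`, which lie over `0` and turn out to be characters `α`, `β` of `G`. So up to a coboundary `Ψ`
equals `α(x)^{carry(y₁, z₁)} β(x)^{carry(y₂, z₂)}` (`exists_characters`).

The two characters have four values on generators. Those of `α(1,0)`, `α(0,1)`, `β(0,1)` are the
standard parameters `a`, `b`, `d`. The contribution of `β(1,0)` can be moved into that of `α(0,1)`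
by explicit coboundaries, and `α(0,1)` matters only up to `m`-th powers of `n`-th roots of unity,
that is, its exponent matters only modulo `gcd(m, n)`. -/

section Cocycles

/-! ### Normalization and dimension shifting for 3-cocycles -/

variable {G A : Type*} [AddCommGroup G] [CommGroup A]

/-- The coboundary of a `2`-cochain with trivial action. -/
def coboundary₃ (h : G → G → A) (x y z : G) : A :=
  h y z * h x (y + z) / (h (x + y) z * h x y)

theorem coboundary₃_mul (h h' : G → G → A) (x y z : G) :
    coboundary₃ (fun x y => h x y * h' x y) x y z = coboundary₃ h x y z * coboundary₃ h' x y z := by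
  simp only [coboundary₃, div_eq_mul_inv, mul_inv]
  ac_rfl

theorem coboundary₃_inv (h : G → G → A) (x y z : G) :
    coboundary₃ (fun x y => (h x y)⁻¹) x y z = (coboundary₃ h x y z)⁻¹ := by
  simp only [coboundary₃, div_eq_mul_inv, mul_inv]

/-- Every `3`-cocycle is cohomologous to a normalized one. -/
theorem exists_normalized (φ : G → G → G → A)
    (hφ : ∀ x y z t, φ y z t * φ x (y + z) t * φ x y z = φ (x + y) z t * φ x y (z + t)) :
    ∃ (Ψ : NormalizedCocycle₃ G A) (h : G → G → A),
      ∀ x y z, φ x y z = Ψ.toFun x y z * coboundary₃ h x y z := by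
  -- Cocycle identities with two adjacent zero arguments express every value of `φ` with a zero
  -- entry through the two functions `φ 0 0 ·` and `φ · 0 0`. The quotient of these two is therefore
  -- the 2-cochain to divide out.
  have h1 : ∀ z t, φ 0 z t * φ 0 0 z = φ 0 0 (z + t) := fun z t => by
    have := hφ 0 0 z t
    simp only [zero_add] at this
    rw [mul_assoc] at this
    exact mul_left_cancel this
  have h2 : ∀ x y, φ y 0 0 * φ x y 0 = φ (x + y) 0 0 := fun x y => by
    have := hφ x y 0 0
    simp only [add_zero] at this
    exact mul_right_cancel this
  have h3 : ∀ x t, φ 0 0 t * φ x 0 0 = φ x 0 t := fun x t => by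
    have := hφ x 0 0 t
    simp only [add_zero, zero_add] at this
    rw [mul_right_comm] at this
    exact mul_right_cancel this
  have h4 : φ 0 0 0 = 1 := by
    have := h1 0 0
    simpa using this
  have hd : ∀ x y z, φ x y z = φ x y z * (φ y 0 0 / φ (x + y) 0 0 * (φ 0 0 y / φ 0 0 (y + z))) *
      coboundary₃ (fun x y => φ 0 0 y / φ x 0 0) x y z := fun x y z => by
    simp only [coboundary₃]
    generalize φ x y z = p, φ y 0 0 = q, φ (x + y) 0 0 = r, φ 0 0 y = s, φ 0 0 (y + z) = t,
      φ 0 0 z = i, φ x 0 0 = j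
    apply Additive.ofMul.injective
    simp only [ofMul_mul, ofMul_div]
    abel
  refine ⟨⟨fun x y z => φ x y z * (φ y 0 0 / φ (x + y) 0 0 * (φ 0 0 y / φ 0 0 (y + z))),
    fun x y z t => ?_, fun y z => ?_, fun x z => ?_, fun x y => ?_⟩, _, hd⟩
  · have := congrArg Additive.ofMul (hφ x y z t)
    apply Additive.ofMul.injective
    simp only [ofMul_mul, ofMul_div, ← add_assoc] at this ⊢
    linear_combination (norm := abel) this
  · simp only [← h1 y z, zero_add]
    apply Additive.ofMul.injective
    simp only [ofMul_mul, ofMul_div, ofMul_one]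
    abel
  · simp only [← h3 x z, add_zero, zero_add, h4]
    apply Additive.ofMul.injective
    simp only [ofMul_mul, ofMul_div, ofMul_one]
    abel
  · simp only [← h2 x y, add_zero]
    apply Additive.ofMul.injective
    simp only [ofMul_mul, ofMul_div, ofMul_one]
    abel

/-- The monoid extension of `G` by the functions `f : G → A` with `f 0 = 1` that is determined by
a normalized `3`-cocycle, read as a `2`-cocycle with values in functions. -/
@[ext]
structure CocycleExt (Ψ : NormalizedCocycle₃ G A) where
  fn : G → A
  pt : G
  fn_zero : fn 0 = 1

namespace CocycleExt

variable {Ψ : NormalizedCocycle₃ G A}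

/-- A function with value `1` at `0` represents a class modulo constants. Group elements act by
translation, and the division by `q.fn p.pt` restores the normalization. Associativity is the
3-cocycle identity, with the first argument of `Ψ` serving as the variable of the function. -/
instance : Monoid (CocycleExt Ψ) where
  mul p q := ⟨fun x => p.fn x * (q.fn (x + p.pt) / q.fn p.pt) * Ψ.toFun x p.pt q.pt, p.pt + q.pt,
    by simp [p.fn_zero, Ψ.map_zero_left]⟩
  one := ⟨fun _ => 1, 0, rfl⟩
  one_mul p := by
    refine CocycleExt.ext (funext fun x => ?_) (zero_add _)
    change 1 * (p.fn (x + 0) / p.fn 0) * Ψ.toFun x 0 p.pt = p.fn x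
    simp [p.fn_zero, Ψ.map_zero_mid]
  mul_one p := by
    refine CocycleExt.ext (funext fun x => ?_) (add_zero _)
    change p.fn x * (1 / 1) * Ψ.toFun x p.pt 0 = p.fn x
    simp [Ψ.map_zero_right]
  mul_assoc p q r := by
    refine CocycleExt.ext (funext fun x => ?_) (add_assoc _ _ _)
    change p.fn x * (q.fn (x + p.pt) / q.fn p.pt) * Ψ.toFun x p.pt q.pt *
      (r.fn (x + (p.pt + q.pt)) / r.fn (p.pt + q.pt)) * Ψ.toFun x (p.pt + q.pt) r.pt =
      p.fn x * (q.fn (x + p.pt) * (r.fn (x + p.pt + q.pt) / r.fn q.pt) *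
        Ψ.toFun (x + p.pt) q.pt r.pt / (q.fn p.pt * (r.fn (p.pt + q.pt) / r.fn q.pt) *
        Ψ.toFun p.pt q.pt r.pt)) * Ψ.toFun x p.pt (q.pt + r.pt)
    have := congrArg Additive.ofMul (Ψ.cocycle x p.pt q.pt r.pt)
    apply Additive.ofMul.injective
    simp only [ofMul_mul, ofMul_div, ← add_assoc] at this ⊢
    linear_combination (norm := abel) this

theorem mul_fn (p q : CocycleExt Ψ) (x : G) :
    (p * q).fn x = p.fn x * (q.fn (x + p.pt) / q.fn p.pt) * Ψ.toFun x p.pt q.pt := rfl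

theorem mul_pt (p q : CocycleExt Ψ) : (p * q).pt = p.pt + q.pt := rfl

theorem one_pt : (1 : CocycleExt Ψ).pt = 0 := rfl

theorem pow_pt (p : CocycleExt Ψ) (i : ℕ) : (p ^ i).pt = i • p.pt := by
  induction i with
  | zero => rw [pow_zero, zero_nsmul, one_pt]
  | succ i ih => rw [pow_succ, mul_pt, ih, succ_nsmul]

end CocycleExt

end Cocycles

/-! ### Multiplicative difference equations on cyclic groups and their products -/

section Divisible

variable {A : Type*} [CommGroup A]

/-- On a cyclic group, functions of total product `1` are multiplicative differences. -/
theorem exists_eq_div_of_prod_eq_one {m : ℕ} [NeZero m] (f : ZMod m → A) (hf : ∏ x, f x = 1) :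
    ∃ v : ZMod m → A, ∀ x, v (x + 1) / v x = f x := by
  have hprod : ∏ i ∈ Finset.range m, f i = 1 := by
    rw [← hf]
    refine Finset.prod_bij' (fun i _ => (i : ZMod m)) (fun x _ => x.val) ?_ ?_ ?_ ?_ ?_
    · simp
    · exact fun x _ => Finset.mem_range.2 (ZMod.val_lt x)
    · exact fun i hi => ZMod.val_cast_of_lt (Finset.mem_range.1 hi)
    · exact fun x _ => ZMod.natCast_zmod_val x
    · simp
  -- The solution is given by partial products. Total product `1` makes them consistent at the
  -- wrap-around from `m - 1` to `0`.
  have hmod : ∀ i ≤ m, ∏ j ∈ Finset.range (i % m), f j = ∏ j ∈ Finset.range i, f j := by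
    intro i hi
    rcases hi.lt_or_eq with h | h
    · rw [Nat.mod_eq_of_lt h]
    · rw [h, Nat.mod_self, hprod, Finset.range_zero, Finset.prod_empty]
  refine ⟨fun x => ∏ j ∈ Finset.range x.val, f j, fun x => ?_⟩
  have : (x + 1).val = (x.val + 1) % m := by
    rw [← ZMod.val_natCast, Nat.cast_add, ZMod.natCast_zmod_val, Nat.cast_one]
  simp only [this, hmod _ (ZMod.val_lt x), Finset.prod_range_succ, ZMod.natCast_zmod_val]
  rw [mul_div_cancel_left]

/-- The products of `f` over the lines with fixed second coordinate have total product `1`, hence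
are differences of some `p` in the second direction. A function `u` supported on the points with
first coordinate `0` absorbs them; what is left has product `1` on every line and is solved line by
line in the first direction. -/
theorem exists_eq_div_mul_div_of_prod_eq_one {m n : ℕ} [NeZero m] [NeZero n]
    (f : ZMod m × ZMod n → A) (hf : ∏ x, f x = 1) :
    ∃ u v : ZMod m × ZMod n → A, ∀ x,
      v (x + (1, 0)) / v x * (u x / u (x + (0, 1))) = f x := by
  rw [Fintype.prod_prod_type_right] at hf
  obtain ⟨p, hp⟩ := exists_eq_div_of_prod_eq_one (fun j => ∏ i, f (i, j)) hf
  have hu : ∀ j : ZMod n, ∏ i : ZMod m, f (i, j) * (if i = 0 then p j / p (j + 1) else 1) = 1 := by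
    intro j
    rw [Finset.prod_mul_distrib, Finset.prod_ite_eq', if_pos (Finset.mem_univ _), ← hp j,
      div_mul_div_cancel, div_self']
  choose v hv using fun j => exists_eq_div_of_prod_eq_one _ (hu j)
  refine ⟨fun x => if x.1 = 0 then (p x.2)⁻¹ else 1, fun x => v x.2 x.1, fun x => ?_⟩
  obtain ⟨i, j⟩ := x
  simp only [Prod.mk_add_mk, add_zero, hv j i]
  split_ifs
  · apply Additive.ofMul.injective
    simp only [ofMul_mul, ofMul_div, ofMul_inv]
    abel
  · simp

end Divisible

/-! ### Representatives for the 3-cocycles of ℤ_m × ℤ_n -/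

section CyclicProduct

variable {A : Type*} [CommGroup A] {m n : ℕ} [NeZero m] [NeZero n]

/-- The carry of the addition of residues modulo `m`. -/
def carry {m : ℕ} (x y : ZMod m) : ℕ := (x.val + y.val) / m

theorem val_add_add_mul_carry (x y : ZMod m) : (x + y).val + m * carry x y = x.val + y.val := by
  rw [ZMod.val_add, carry, Nat.mod_add_div]

omit [NeZero m] in
theorem carry_comm (x y : ZMod m) : carry x y = carry y x := by
  rw [carry, carry, add_comm]

theorem carry_cocycle (x y z : ZMod m) :
    carry y z + carry x (y + z) = carry (x + y) z + carry x y := by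
  have h := zmod_carry x y z
  change carry z (x + y) + carry y x = carry z y + carry (y + z) x at h
  rw [carry_comm z (x + y), carry_comm y x, carry_comm z y, carry_comm (y + z) x] at h
  rw [h]

/-- A cocycle with values in a divisible group lifts to commuting elements of the extension. -/
theorem CocycleExt.exists_commute (hA : ∀ n : ℕ, n ≠ 0 → ∀ a : A, ∃ b, b ^ n = a)
    (Ψ : NormalizedCocycle₃ (ZMod m × ZMod n) A) :
    ∃ X Y : CocycleExt Ψ, X.pt = (1, 0) ∧ Y.pt = (0, 1) ∧ Commute X Y := by
  -- `κ` is the ratio of the cocycle factors in `Y * X` and `X * Y`, so commutation asks for `κ` to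
  -- be a difference expression in `u` and `v`, up to a constant. Divisibility supplies a constant
  -- `c` for which `c * κ` has total product `1`.
  set κ : ZMod m × ZMod n → A := fun x => Ψ.toFun x (0, 1) (1, 0) / Ψ.toFun x (1, 0) (0, 1)
    with hκ
  obtain ⟨c, hc⟩ := hA (Fintype.card (ZMod m × ZMod n)) Fintype.card_ne_zero (∏ x, κ x)⁻¹
  obtain ⟨u, v, huv⟩ := exists_eq_div_mul_div_of_prod_eq_one (fun x => c * κ x) (by
    rw [Finset.prod_mul_distrib, Finset.prod_const, Finset.card_univ, hc, inv_mul_cancel])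
  refine ⟨⟨fun x => u x / u 0, (1, 0), div_self' _⟩, ⟨fun x => v x / v 0, (0, 1), div_self' _⟩,
    rfl, rfl, ?_⟩
  -- Functions are normalized at `0`, so the equation at `x` is divided by the equation at `0`, and
  -- `c` cancels.
  refine CocycleExt.ext (funext fun x => ?_) (add_comm _ _)
  have h0 := congrArg Additive.ofMul (huv 0)
  have hx := congrArg Additive.ofMul (huv x)
  simp only [hκ, Ψ.map_zero_left, zero_add] at h0 hx
  apply Additive.ofMul.injective
  simp only [mul_fn, ofMul_mul, ofMul_div, ofMul_one] at h0 hx ⊢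
  linear_combination (norm := abel) hx - h0

/-- Every normalized `3`-cocycle of `ℤ_m × ℤ_n` with values in a divisible group is, up to a
coboundary, determined by two characters. -/
theorem exists_characters (hA : ∀ n : ℕ, n ≠ 0 → ∀ a : A, ∃ b, b ^ n = a)
    (Ψ : NormalizedCocycle₃ (ZMod m × ZMod n) A) :
    ∃ (h : ZMod m × ZMod n → ZMod m × ZMod n → A) (α β : ZMod m × ZMod n → A),
      (∀ x y, α (x + y) = α x * α y) ∧ (∀ x y, β (x + y) = β x * β y) ∧
      ∀ x y z, Ψ.toFun x y z = α x ^ carry y.1 z.1 * β x ^ carry y.2 z.2 * coboundary₃ h x y z := by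
  obtain ⟨X, Y, hX, hY, hXY⟩ := CocycleExt.exists_commute hA Ψ
  set T : ℕ → ℕ → CocycleExt Ψ := fun i j => X ^ i * Y ^ j with hT
  have hTpt : ∀ i j, (T i j).pt = ((i : ZMod m), (j : ZMod n)) := fun i j => by
    simp [hT, CocycleExt.mul_pt, CocycleExt.pow_pt, hX, hY]
  have hTadd : ∀ i j i' j', T (i + i') (j + j') = T i j * T i' j' := fun i j i' j' => by
    simp only [hT, pow_add]
    rw [mul_assoc, mul_assoc, ← mul_assoc (X ^ i'), (hXY.pow_pow i' j).eq, mul_assoc]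
  have hTfn : ∀ i j i' j' x, (T (i + i') (j + j')).fn x = (T i j).fn x *
      ((T i' j').fn (x + ((i : ZMod m), (j : ZMod n))) / (T i' j').fn (i, j)) *
        Ψ.toFun x (i, j) (i', j') :=
    fun i j i' j' x => by rw [hTadd, CocycleExt.mul_fn, hTpt, hTpt]
  -- The elements `T (m * i) (n * j)` lie over `0`: as left factors they translate nothing, and `Ψ`
  -- contributes `1`.
  have hL0 : ∀ i j, (((m * i : ℕ) : ZMod m), ((n * j : ℕ) : ZMod n)) = 0 := fun i j => by
    ext <;> simp
  have hper : ∀ i j i' j' x, (T (i + m * i') (j + n * j')).fn x =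
      (T i j).fn x * (T (m * i') (n * j')).fn x := fun i j i' j' x => by
    rw [add_comm i, add_comm j, hTfn, hL0, Ψ.map_zero_mid, add_zero, (T i j).fn_zero, div_one,
      mul_one, mul_comm]
  -- As right factor, a lattice element has its function translated by the other point; as left
  -- factor it does not. By additivity of `T` both products agree, which forces the function to be
  -- multiplicative.
  have hchar : ∀ i j x y, (T (m * i) (n * j)).fn (x + y) =
      (T (m * i) (n * j)).fn x * (T (m * i) (n * j)).fn y := fun i j x y => by
    have h1 := hTfn y.1.val y.2.val (m * i) (n * j) x
    rw [hper, hL0, Ψ.map_zero_right, mul_one, mul_right_inj, ZMod.natCast_zmod_val,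
      ZMod.natCast_zmod_val, eq_div_iff_mul_eq'] at h1
    exact h1.symm
  have hlat : ∀ i j x, (T (m * i) (n * j)).fn x = (T m 0).fn x ^ i * (T 0 n).fn x ^ j := by
    intro i j x
    have h1 : ∀ i, (T (m * i) 0).fn x = (T m 0).fn x ^ i := fun i => by
      induction i with
      | zero => simp [hT]; rfl
      | succ i ih =>
        have := hper (m * i) 0 1 0 x
        rw [mul_one, mul_zero, add_zero] at this
        rw [mul_add, mul_one, this, ih, pow_succ]
    have h2 : ∀ j, (T 0 (n * j)).fn x = (T 0 n).fn x ^ j := fun j => by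
      induction j with
      | zero => simp [hT]; rfl
      | succ i ih =>
        have := hper 0 (n * i) 0 1 x
        rw [mul_one, mul_zero, add_zero] at this
        rw [mul_add, mul_one, this, ih, pow_succ]
    have := hper (m * i) 0 0 j x
    rw [mul_zero, add_zero, zero_add] at this
    rw [this, h1, h2]
  -- The cochain `h` evaluates `T` on reduced representatives. Adding two representatives may leave
  -- the box `[0, m) × [0, n)`, and each carry then costs a factor `α` or `β`.
  refine ⟨fun x y => (T y.1.val y.2.val).fn x, (T m 0).fn, (T 0 n).fn, fun x y => ?_, fun x y => ?_,
    fun x y z => ?_⟩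
  · simpa using hchar 1 0 x y
  · simpa using hchar 0 1 x y
  · have h1 := hTfn y.1.val y.2.val z.1.val z.2.val x
    rw [← val_add_add_mul_carry y.1, ← val_add_add_mul_carry y.2, hper, hlat] at h1
    simp only [ZMod.natCast_zmod_val] at h1
    apply Additive.ofMul.injective
    replace h1 := congrArg Additive.ofMul h1
    simp only [coboundary₃, ofMul_mul, ofMul_div, Prod.fst_add, Prod.snd_add] at h1 ⊢
    linear_combination (norm := abel) -h1

/-- The product of the integer residues of `p x` and `q y` fails to be biadditive exactly by the
carries. This trades the cup product of `p` with the carry of `q`, scaled by `n`, for that of the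
carry of `p` with `q`, scaled by `m`. -/
theorem coboundary₃_val_mul_val {G : Type*} [AddCommGroup G] (p : G →+ ZMod m) (q : G →+ ZMod n)
    (l : A) (x y z : G) :
    coboundary₃ (fun x y => l ^ ((p x).val * (q y).val)) x y z *
      l ^ (n * ((p x).val * carry (q y) (q z))) = l ^ (m * (carry (p x) (p y) * (q z).val)) := by
  rw [coboundary₃, div_mul_eq_mul_div, div_eq_iff_eq_mul]
  simp only [← pow_add, map_add]
  congr 1
  have h1 := val_add_add_mul_carry (p x) (p y)
  have h2 := val_add_add_mul_carry (q y) (q z)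
  zify at h1 h2 ⊢
  linear_combination (p x).val * h2 - (q z).val * h1

/-- A character and an integral `2`-cocycle commute under the cup product. -/
theorem coboundary₃_character {G : Type*} [AddCommGroup G] (χ : G → A)
    (hχ : ∀ x y, χ (x + y) = χ x * χ y) (c : G → G → ℕ)
    (hc : ∀ x y z, c y z + c x (y + z) = c (x + y) z + c x y) (x y z : G) :
    coboundary₃ (fun x y => χ (x + y) ^ c x y) x y z * χ x ^ c y z = χ z ^ c x y := by
  have h : (χ x * χ y * χ z) ^ (c y z + c x (y + z)) =
    (χ x * χ y * χ z) ^ (c (x + y) z + c x y) := by rw [hc]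
  simp only [coboundary₃, hχ]
  replace h := congrArg Additive.ofMul h
  apply Additive.ofMul.injective
  simp only [pow_add, mul_pow, ofMul_mul, ofMul_div] at h ⊢
  linear_combination (norm := abel) h

theorem character_nsmul {G : Type*} [AddCommGroup G] (χ : G → A)
    (hχ : ∀ x y, χ (x + y) = χ x * χ y) (i : ℕ) (y : G) : χ (i • y) = χ y ^ i := by
  induction i with
  | zero => simpa using hχ 0 0
  | succ i ih => rw [succ_nsmul, hχ, ih, pow_succ]

theorem character_eq (χ : ZMod m × ZMod n → A) (hχ : ∀ x y, χ (x + y) = χ x * χ y)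
    (x : ZMod m × ZMod n) : χ x = χ (1, 0) ^ x.1.val * χ (0, 1) ^ x.2.val := by
  rw [← character_nsmul χ hχ, ← character_nsmul χ hχ, ← hχ]
  congr 1
  ext <;> simp

omit [NeZero m] [NeZero n] in
theorem character_pow_card (χ : ZMod m × ZMod n → A) (hχ : ∀ x y, χ (x + y) = χ x * χ y) :
    χ (1, 0) ^ m = 1 ∧ χ (0, 1) ^ n = 1 := by
  have h0 : χ 0 = 1 := by simpa using hχ 0 0
  rw [← character_nsmul χ hχ, ← character_nsmul χ hχ]
  constructor <;> rw [← h0] <;> congr 1 <;> ext <;> simp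

/-- Every `3`-cocycle of `ℤ_m × ℤ_n` with values in a divisible group whose `m`-torsion and
`n`-torsion are cyclic is cohomologous to a standard one. -/
theorem exists_cocycleABD (hA : ∀ n : ℕ, n ≠ 0 → ∀ a : A, ∃ b, b ^ n = a) (ζm ζn : A)
    (hζm : ζm ^ m = 1) (hζn : ζn ^ n = 1) (hm : ∀ ξ : A, ξ ^ m = 1 → ∃ i : ℕ, ζm ^ i = ξ)
    (hn : ∀ ξ : A, ξ ^ n = 1 → ∃ i : ℕ, ζn ^ i = ξ)
    (φ : ZMod m × ZMod n → ZMod m × ZMod n → ZMod m × ZMod n → A)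
    (hφ : ∀ x y z t, φ y z t * φ x (y + z) t * φ x y z = φ (x + y) z t * φ x y (z + t)) :
    ∃ (a b d : ℕ) (h : ZMod m × ZMod n → ZMod m × ZMod n → A), a < m ∧ b < Nat.gcd m n ∧ d < n ∧
      ∀ x y z, φ x y z =
        (cocycleABD m n ζm ζn hζm hζn a b d).toFun x y z * coboundary₃ h x y z := by
  obtain ⟨Ψ, h₀, hΨ⟩ := exists_normalized φ hφ
  obtain ⟨h₁, α, β, hα, hβ, hαβ⟩ := exists_characters hA Ψ
  obtain ⟨hα₁, hα₂⟩ := character_pow_card α hα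
  obtain ⟨hβ₁, hβ₂⟩ := character_pow_card β hβ
  obtain ⟨a, ha⟩ := hm _ hα₁
  obtain ⟨b, hb⟩ := hn _ hα₂
  obtain ⟨d, hd⟩ := hn _ hβ₂
  -- Preparation for moving `β (1, 0)`: with `l ^ n = β (1, 0)`, the element `l ^ m` is an `n`-th
  -- root of unity because `β (1, 0) ^ m = 1`. Its exponent `e` will be added to `b`.
  obtain ⟨l, hl⟩ := hA n (NeZero.ne n) (β (1, 0))
  obtain ⟨e, he⟩ := hn (l ^ m) (by rw [← pow_mul, mul_comm, pow_mul, hl, hβ₁])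
  set g := Nat.gcd m n with hg
  -- By Bézout, `g = m * gcdA + n * gcdB`, so the multiple of `g` removed from `b + e` gives an
  -- `m`-th power `θ ^ m` with `θ ^ n = 1`.
  set θ : A := ζn ^ (Nat.gcdA m n * ((b + e) / g : ℕ)) with hθ
  have hθn : θ ^ n = 1 := by
    rw [hθ, ← zpow_natCast, ← zpow_mul, mul_comm, zpow_mul, zpow_natCast, hζn, one_zpow]
  have hθm : ζn ^ (b + e) = ζn ^ ((b + e) % g) * θ ^ m := by
    have hz : ζn ^ ((n : ℤ) * Nat.gcdB m n * ((b + e) / g : ℕ)) = 1 := by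
      rw [mul_assoc, zpow_mul, zpow_natCast, hζn, one_zpow]
    have hgz : ((b + e) % g : ℕ) + ((m : ℤ) * Nat.gcdA m n + n * Nat.gcdB m n) *
        ((b + e) / g : ℕ) = (b + e : ℕ) := by
      rw [← Nat.gcd_eq_gcd_ab, ← hg]
      exact_mod_cast Nat.mod_add_div (b + e) g
    rw [← zpow_natCast ζn (b + e), ← hgz, add_mul, zpow_add, zpow_add, hz, mul_one, zpow_natCast,
      hθ, ← zpow_natCast _ m, ← zpow_mul]
    congr 2
    ring
  refine ⟨a % m, (b + e) % g, d % n, fun x y => h₀ x y * (h₁ x y *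
    ((l ^ (x.1.val * y.2.val))⁻¹ * (((ζn ^ e) ^ (x + y).2.val) ^ carry x.1 y.1 *
      (θ ^ (x.2.val * y.1.val))⁻¹))), Nat.mod_lt _ (Nat.pos_of_ne_zero (NeZero.ne m)),
    Nat.mod_lt _ (Nat.gcd_pos_of_pos_left _ (Nat.pos_of_ne_zero (NeZero.ne m))),
    Nat.mod_lt _ (Nat.pos_of_ne_zero (NeZero.ne n)), fun x y z => ?_⟩
  -- `k1` turns the `β (1, 0)` term into powers of `ζn ^ e` with exponent `carry x.1 y.1 * z.2.val`,
  -- `k2` moves the carry back to the last two arguments, and `k3` shows that the `θ ^ m` term is a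
  -- coboundary, its other side being trivial because `θ ^ n = 1`.
  have k1 := coboundary₃_val_mul_val (AddMonoidHom.fst (ZMod m) (ZMod n))
    (AddMonoidHom.snd (ZMod m) (ZMod n)) l x y z
  have k2 := coboundary₃_character (fun x : ZMod m × ZMod n => (ζn ^ e) ^ x.2.val) (fun x y => by
    have := pow_mul_zmod_val_add hζn e x.2 y.2
    rw [← pow_mul, ← pow_mul, ← pow_mul, Prod.snd_add, this, mul_add, pow_add])
    (fun x y => carry x.1 y.1) (fun x y z => carry_cocycle _ _ _) x y z
  have k3 := coboundary₃_val_mul_val (AddMonoidHom.snd (ZMod m) (ZMod n))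
    (AddMonoidHom.fst (ZMod m) (ZMod n)) θ x y z
  have hΦ : (cocycleABD m n ζm ζn hζm hζn (a % m) ((b + e) % g) (d % n)).toFun x y z =
      (ζm ^ a) ^ (carry y.1 z.1 * x.1.val) * (ζn ^ ((b + e) % g)) ^ (carry y.1 z.1 * x.2.val) *
        (ζn ^ d) ^ (carry y.2 z.2 * x.2.val) := by
    rw [pow_eq_pow_mod a hζm, pow_eq_pow_mod d hζn, carry_comm y.1]
    simp only [cocycleABD, carry, ← pow_mul, mul_assoc]
  rw [hΨ, hαβ, hΦ, character_eq α hα, character_eq β hβ]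
  simp only [coboundary₃_mul, coboundary₃_inv]
  simp only [AddMonoidHom.coe_fst, AddMonoidHom.coe_snd, pow_mul, hl, hθn, one_pow, ha, hd]
    at k1 k2 k3 ⊢
  rw [← he] at k1
  replace hθm := congrArg Additive.ofMul hθm
  replace k1 := congrArg Additive.ofMul k1
  replace k2 := congrArg Additive.ofMul k2
  replace k3 := congrArg Additive.ofMul k3
  apply Additive.ofMul.injective
  simp only [mul_pow, pow_add, hb, ofMul_mul, ofMul_inv, ofMul_pow, ofMul_one] at hθm k1 k2 k3 ⊢
  linear_combination (norm := module) k1 - k2 + k3 + (x.2.val * carry y.1 z.1) • hθm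

end CyclicProduct

/-! ### One-dimensional graded spaces as probes -/

namespace GrVec

section Simple

theorem tmul_ne_zero {k M N : Type*} [Field k] [AddCommGroup M] [Module k M] [AddCommGroup N]
    [Module k N] {a : M} {b : N} (ha : a ≠ 0) (hb : b ≠ 0) : a ⊗ₜ[k] b ≠ 0 := by
  intro h
  obtain ⟨f, hf⟩ : ∃ f : Module.Dual k M, f a ≠ 0 := by
    by_contra! h'
    exact ha ((Module.forall_dual_apply_eq_zero_iff k a).1 h')
  obtain ⟨g, hg⟩ : ∃ g : Module.Dual k N, g b ≠ 0 := by
    by_contra! h'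
    exact hb ((Module.forall_dual_apply_eq_zero_iff k b).1 h')
  have := congrArg (TensorProduct.lid k k ∘ TensorProduct.map f g) h
  simp [hf, hg] at this

variable (k : Type u) [Field k] {G : Type w} [DecidableEq G]

/-- The one-dimensional graded space concentrated in degree `g`. -/
@[reducible]
def simple (g : G) : GrVec k G where
  carrier := k
  deg h := if h = g then ⊤ else ⊥
  isInternal := by
    refine DirectSum.isInternal_submodule_of_iSupIndep_of_iSup_eq_top ?_ ?_
    · intro i
      by_cases hi : i = g
      · have : (⨆ j, ⨆ (_ : j ≠ i), if j = g then (⊤ : Submodule k k) else ⊥) = ⊥ :=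
          iSup_eq_bot.2 fun j => iSup_eq_bot.2 fun hj => if_neg fun h => hj (h.trans hi.symm)
        rw [this]
        exact disjoint_bot_right
      · change Disjoint (if i = g then (⊤ : Submodule k k) else ⊥) _
        rw [if_neg hi]
        exact disjoint_bot_left
    · rw [eq_top_iff]
      exact le_iSup_of_le g (by rw [if_pos rfl])

variable {k}

theorem one_mem_deg_simple (g : G) : (1 : k) ∈ (simple k g).deg g := by
  change (1 : k) ∈ (if g = g then (⊤ : Submodule k k) else ⊥)
  rw [if_pos rfl]
  exact Submodule.mem_top

/-- The morphism from the one-dimensional space of degree `g` that picks a vector. -/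
def simpleHom {V : GrVec k G} {g : G} {v : V} (hv : v ∈ V.deg g) : simple k g ⟶ V where
  lin := LinearMap.toSpanSingleton k V v
  map_deg h c hc := by
    change c ∈ (if h = g then (⊤ : Submodule k k) else ⊥) at hc
    split_ifs at hc with hh
    · rw [hh]
      exact (V.deg g).smul_mem c hv
    · rw [(Submodule.mem_bot k).1 hc, map_zero]
      exact Submodule.zero_mem _

theorem lin_injective {V W : GrVec k G} (f : V ≅ W) : Function.Injective (Hom.lin f.hom) := by
  refine Function.LeftInverse.injective (g := Hom.lin f.inv) fun v => ?_
  rw [← LinearMap.comp_apply, ← comp_lin, f.hom_inv_id, id_lin, LinearMap.id_apply]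

theorem eq_zero_of_lin_eq_zero {V W : GrVec k G} (f : V ≅ W) {v : V} (h : Hom.lin f.hom v = 0) :
    v = 0 :=
  lin_injective f (h.trans (map_zero _).symm)

theorem lin_inv_apply {V W : GrVec k G} (f : V ≅ W) (w : W) :
    Hom.lin f.hom (Hom.lin f.inv w) = w := by
  rw [← LinearMap.comp_apply, ← comp_lin, f.inv_hom_id, id_lin, LinearMap.id_apply]

end Simple

/-! ### Scalar automorphisms of tensor products -/

section Tensorator

variable {k : Type u} [Field k] {G : Type w} [DecidableEq G] [Fintype G]

/-- Multiplication of the summand `U_x ⊗ V_y` of `U ⊗ V` by the scalar `h(x, y)`. -/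
noncomputable def twist₂ (h : G → G → kˣ) (U V : GrVec k G) : U ⊗[k] V →ₗ[k] U ⊗[k] V :=
  ∑ x, ∑ y, (h x y : k) • TensorProduct.map (U.proj x) (V.proj y)

theorem twist₂_tmul (h : G → G → kˣ) {U V : GrVec k G} {x y : G} {a : U} {b : V}
    (ha : a ∈ U.deg x) (hb : b ∈ V.deg y) :
    twist₂ h U V (a ⊗ₜ[k] b) = (h x y : k) • (a ⊗ₜ[k] b) := by
  simp only [twist₂, LinearMap.sum_apply, LinearMap.smul_apply, TensorProduct.map_tmul]
  rw [Finset.sum_eq_single x, Finset.sum_eq_single y, proj_of_mem U ha, proj_of_mem V hb]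
  · intro y' _ hy
    rw [proj_of_mem_ne V hy.symm hb, TensorProduct.tmul_zero, smul_zero]
  · exact fun h => absurd (Finset.mem_univ y) h
  · intro x' _ hx
    refine Finset.sum_eq_zero fun y' _ => ?_
    rw [proj_of_mem_ne U hx.symm ha, TensorProduct.zero_tmul, smul_zero]
  · exact fun h => absurd (Finset.mem_univ x) h

theorem twist₂_twist₂ {h h' : G → G → kˣ} (hh : ∀ x y, h x y * h' x y = 1) (U V : GrVec k G) :
    twist₂ h U V ∘ₗ twist₂ h' U V = LinearMap.id :=
  tensor_ext fun x a ha y b hb => by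
    rw [LinearMap.comp_apply, twist₂_tmul _ ha hb, map_smul, twist₂_tmul _ ha hb, smul_smul,
      mul_comm, ← Units.val_mul, hh, Units.val_one, one_smul, LinearMap.id_apply]

variable [AddGroup G]

/-- The multiplication by `h` as a morphism of graded spaces. -/
noncomputable def twistHom (h : G → G → kˣ) (U V : GrVec k G) : tensorObj U V ⟶ tensorObj U V where
  lin := twist₂ h U V
  map_deg g t ht := by
    have : tensorDeg U V g ≤ (tensorDeg U V g).comap (twist₂ h U V) :=
      tensorDeg_le.2 fun x y hxy a ha b hb => by
        rw [Submodule.mem_comap, twist₂_tmul h ha hb, ← hxy]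
        exact Submodule.smul_mem _ _ (tmul_mem_tensorDeg ha hb)
    exact this ht

/-- The multiplication by `h` as an isomorphism of graded spaces. -/
noncomputable def twistIso (h : G → G → kˣ) (U V : GrVec k G) : tensorObj U V ≅ tensorObj U V where
  hom := twistHom h U V
  inv := twistHom (fun x y => (h x y)⁻¹) U V
  hom_inv_id := hom_ext (twist₂_twist₂ (fun _ _ => inv_mul_cancel _) U V)
  inv_hom_id := hom_ext (twist₂_twist₂ (fun _ _ => mul_inv_cancel _) U V)

theorem twistIso_hom_tmul (h : G → G → kˣ) {U V : GrVec k G} {x y : G} {a : U} {b : V}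
    (ha : a ∈ U.deg x) (hb : b ∈ V.deg y) :
    Hom.lin (twistIso h U V).hom (a ⊗ₜ[k] b) = (h x y : k) • (a ⊗ₜ[k] b) :=
  twist₂_tmul h ha hb

theorem twistIso_naturality (h : G → G → kˣ) {U U' V V' : GrVec k G} (f : U ⟶ U') (g : V ⟶ V') :
    tensorHom f g ≫ (twistIso h U' V').hom = (twistIso h U V).hom ≫ tensorHom f g :=
  hom_ext <| tensor_ext fun x a ha y b hb => by
    simp only [comp_lin, LinearMap.comp_apply]
    rw [twistIso_hom_tmul h ha hb, map_smul]
    exact twistIso_hom_tmul h (Hom.map_deg f x a ha) (Hom.map_deg g y b hb)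

end Tensorator

/-! ### Scalars underlying a monoidal structure -/

namespace MonoidalStructure

variable {k : Type u} [Field k] {G : Type w} [DecidableEq G] [AddGroup G] [Fintype G]
  (S : MonoidalStructure k G)

/-- The associator of a monoidal structure is given by scalars. -/
theorem exists_assoc_tmul : ∃ φ : G → G → G → kˣ, ∀ (U V W : GrVec k G) (x y z : G)
    (a : U) (b : V) (c : W), a ∈ U.deg x → b ∈ V.deg y → c ∈ W.deg z →
    Hom.lin (S.assoc U V W).hom ((a ⊗ₜ[k] b) ⊗ₜ[k] c) =
      (φ x y z : k) • (a ⊗ₜ[k] (b ⊗ₜ[k] c)) := by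
  -- On one-dimensional spaces the associator is an isomorphism between lines, hence a nonzero
  -- scalar.
  have key : ∀ x y z : G, ∃ c : kˣ,
      Hom.lin (S.assoc (simple k x) (simple k y) (simple k z)).hom
        (((1 : k) ⊗ₜ[k] (1 : k)) ⊗ₜ[k] (1 : k)) =
          (c : k) • ((1 : k) ⊗ₜ[k] ((1 : k) ⊗ₜ[k] (1 : k))) := by
    intro x y z
    have hspan : ∀ t : k ⊗[k] (k ⊗[k] k), ∃ c : k,
        t = c • ((1 : k) ⊗ₜ[k] ((1 : k) ⊗ₜ[k] (1 : k))) := fun t => by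
      refine ⟨TensorProduct.lid k k (TensorProduct.map LinearMap.id
        (TensorProduct.lid k k).toLinearMap t), ?_⟩
      apply (TensorProduct.congr (LinearEquiv.refl k k) (TensorProduct.lid k k)).injective
      apply (TensorProduct.lid k k).injective
      rw [map_smul, map_smul]
      simp
      rfl
    obtain ⟨c, hc⟩ := hspan (Hom.lin (S.assoc (simple k x) (simple k y) (simple k z)).hom
        (((1 : k) ⊗ₜ[k] (1 : k)) ⊗ₜ[k] (1 : k)))
    refine ⟨Units.mk0 c fun h0 => ?_, hc⟩
    rw [h0, zero_smul] at hc
    have h1 := eq_zero_of_lin_eq_zero _ hc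
    have h2 := congrArg (TensorProduct.lid k k)
      (congrArg (TensorProduct.map (TensorProduct.lid k k).toLinearMap LinearMap.id) h1)
    simp at h2
  choose φ hφ using key
  refine ⟨φ, fun U V W x y z a b c ha hb hc => ?_⟩
  -- Naturality along the morphisms `simpleHom` picking `a`, `b`, `c` carries the scalar to
  -- arbitrary spaces.
  have h := congrArg (fun f => Hom.lin f (((1 : k) ⊗ₜ[k] (1 : k)) ⊗ₜ[k] (1 : k)))
    (S.assoc_naturality (simpleHom ha) (simpleHom hb) (simpleHom hc))
  simp only [comp_lin, LinearMap.comp_apply] at h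
  rw [hφ, map_smul] at h
  have e : Hom.lin (S.assoc U V W).hom ((((1 : k) • a) ⊗ₜ[k] ((1 : k) • b)) ⊗ₜ[k] ((1 : k) • c)) =
    (φ x y z : k) • (((1 : k) • a) ⊗ₜ[k] (((1 : k) • b) ⊗ₜ[k] ((1 : k) • c))) := h
  simpa only [one_smul] using e

/-- Both sides of the pentagon multiply a homogeneous pure tensor by a scalar. On one-dimensional
spaces this tensor can be chosen nonzero, so the scalars agree. -/
theorem assoc_cocycle {φ : G → G → G → kˣ} (hφ : ∀ (U V W : GrVec k G) (x y z : G)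
    (a : U) (b : V) (c : W), a ∈ U.deg x → b ∈ V.deg y → c ∈ W.deg z →
    Hom.lin (S.assoc U V W).hom ((a ⊗ₜ[k] b) ⊗ₜ[k] c) =
      (φ x y z : k) • (a ⊗ₜ[k] (b ⊗ₜ[k] c))) (x y z t : G) :
    φ y z t * φ x (y + z) t * φ x y z = φ (x + y) z t * φ x y (z + t) := by
  have key : ∀ (T U V W : GrVec k G) (d : T) (a : U) (b : V) (c : W), d ∈ T.deg x → a ∈ U.deg y →
      b ∈ V.deg z → c ∈ W.deg t →
      ((φ y z t * φ x (y + z) t * φ x y z : kˣ) : k) • (d ⊗ₜ[k] (a ⊗ₜ[k] (b ⊗ₜ[k] c))) =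
      ((φ (x + y) z t * φ x y (z + t) : kˣ) : k) • (d ⊗ₜ[k] (a ⊗ₜ[k] (b ⊗ₜ[k] c))) := by
    intro T U V W d a b c hd ha hb hc
    have h1 : Hom.lin (tensorHom (S.assoc T U V).hom (𝟙 W)) (((d ⊗ₜ[k] a) ⊗ₜ[k] b) ⊗ₜ[k] c) =
        (φ x y z : k) • ((d ⊗ₜ[k] (a ⊗ₜ[k] b)) ⊗ₜ[k] c) := by
      rw [tensorHom_lin, TensorProduct.map_tmul, hφ _ _ _ _ _ _ _ _ _ hd ha hb]
      rfl
    have h2 := hφ T (tensorObj U V) W _ _ _ _ _ _ hd (tmul_mem_tensorDeg ha hb) hc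
    have h3 : Hom.lin (tensorHom (𝟙 T) (S.assoc U V W).hom) (d ⊗ₜ[k] ((a ⊗ₜ[k] b) ⊗ₜ[k] c)) =
        (φ y z t : k) • (d ⊗ₜ[k] (a ⊗ₜ[k] (b ⊗ₜ[k] c))) := by
      rw [tensorHom_lin, TensorProduct.map_tmul, hφ _ _ _ _ _ _ _ _ _ ha hb hc,
        TensorProduct.tmul_smul]
      rfl
    have h4 := hφ (tensorObj T U) V W _ _ _ _ _ _ (tmul_mem_tensorDeg hd ha) hb hc
    have h5 := hφ T U (tensorObj V W) _ _ _ _ _ _ hd ha (tmul_mem_tensorDeg hb hc)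
    have h := congrArg (fun f => Hom.lin f (((d ⊗ₜ[k] a) ⊗ₜ[k] b) ⊗ₜ[k] c)) (S.pentagon T U V W)
    simp only [comp_lin, LinearMap.comp_apply] at h
    rw [h1, map_smul, map_smul, h2, map_smul, h3, h4, map_smul, h5, smul_smul, smul_smul,
      smul_smul] at h
    rw [Units.val_mul, Units.val_mul, Units.val_mul, ← h]
    congr 1
    ring
  have h := key (simple k x) (simple k y) (simple k z) (simple k t) _ _ _ _ (one_mem_deg_simple x)
    (one_mem_deg_simple y) (one_mem_deg_simple z) (one_mem_deg_simple t)
  have h1 : ((1 : k) ⊗ₜ[k] ((1 : k) ⊗ₜ[k] ((1 : k) ⊗ₜ[k] (1 : k)))) ≠ 0 :=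
    tmul_ne_zero one_ne_zero (tmul_ne_zero one_ne_zero (tmul_ne_zero one_ne_zero one_ne_zero))
  exact Units.ext (smul_left_injective k h1 h)

/-- The unit object is spanned by a vector of degree `0`, and the unit constraints are given by
scalars. -/
theorem exists_unitors {φ : G → G → G → kˣ} (hφ : ∀ (U V W : GrVec k G) (x y z : G)
    (a : U) (b : V) (c : W), a ∈ U.deg x → b ∈ V.deg y → c ∈ W.deg z →
    Hom.lin (S.assoc U V W).hom ((a ⊗ₜ[k] b) ⊗ₜ[k] c) =
      (φ x y z : k) • (a ⊗ₜ[k] (b ⊗ₜ[k] c))) :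
    ∃ e ∈ S.unit.deg 0, e ≠ 0 ∧ (∀ v : S.unit, ∃ c : k, c • e = v) ∧ ∃ l r : G → kˣ,
      (∀ (V : GrVec k G) (x : G) (v : V), v ∈ V.deg x →
        Hom.lin (S.leftUnitor V).hom (e ⊗ₜ[k] v) = (l x : k) • v) ∧
      (∀ (V : GrVec k G) (x : G) (v : V), v ∈ V.deg x →
        Hom.lin (S.rightUnitor V).hom (v ⊗ₜ[k] e) = (r x : k) • v) ∧
      ∀ x y, φ x 0 y * l y = r x := by
  -- The left unit constraint at a one-dimensional space forces the unit object to be a line.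
  have hfin : Module.finrank k S.unit = 1 := by
    have : (S.unit ⊗[k] k) ≃ₗ[k] k := LinearEquiv.ofBijective
      (Hom.lin (S.leftUnitor (simple k 0)).hom)
      ⟨lin_injective _, fun w => ⟨_, lin_inv_apply _ w⟩⟩
    have := ((TensorProduct.rid k S.unit).symm.trans this).finrank_eq
    rwa [Module.finrank_self] at this
  obtain ⟨g, e, heg, he⟩ : ∃ g, ∃ e ∈ S.unit.deg g, e ≠ 0 := by
    by_contra! h
    have : (LinearMap.id : S.unit →ₗ[k] S.unit) = 0 := S.unit.lin_ext fun g v hv => h g v hv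
    have hs : Subsingleton S.unit := ⟨fun a b => by
      rw [← LinearMap.id_apply (R := k) a, ← LinearMap.id_apply (R := k) b, this]; rfl⟩
    rw [Module.finrank_zero_of_subsingleton] at hfin
    exact zero_ne_one hfin
  -- The left unit constraint preserves degrees and is injective, so `e ⊗ 1`, of degree `g + 0`,
  -- must land in degree `0`.
  have hg : g = 0 := by
    have h1 := Hom.map_deg (S.leftUnitor (simple k 0)).hom _ _
      (tmul_mem_tensorDeg heg (one_mem_deg_simple (k := k) 0))
    by_contra hg
    change _ ∈ (if g + 0 = 0 then (⊤ : Submodule k k) else ⊥) at h1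
    rw [add_zero, if_neg hg, Submodule.mem_bot] at h1
    exact tmul_ne_zero he one_ne_zero (eq_zero_of_lin_eq_zero _ h1)
  subst hg
  have hl : ∀ x : G, Hom.lin (S.leftUnitor (simple k x)).hom (e ⊗ₜ[k] (1 : k)) ≠ (0 : k) :=
    fun x h => tmul_ne_zero he one_ne_zero (eq_zero_of_lin_eq_zero _ h)
  have hr : ∀ x : G, Hom.lin (S.rightUnitor (simple k x)).hom ((1 : k) ⊗ₜ[k] e) ≠ (0 : k) :=
    fun x h => tmul_ne_zero one_ne_zero he (eq_zero_of_lin_eq_zero _ h)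
  have hl' : ∀ (V : GrVec k G) (x : G) (v : V), v ∈ V.deg x →
      Hom.lin (S.leftUnitor V).hom (e ⊗ₜ[k] v) = (Units.mk0 _ (hl x) : k) • v := by
    intro V x v hv
    have h := congrArg (fun f => Hom.lin f (e ⊗ₜ[k] (1 : k)))
      (S.leftUnitor_naturality (simpleHom hv))
    have h' : Hom.lin (S.leftUnitor V).hom (e ⊗ₜ[k] ((1 : k) • v)) = _ := h
    rw [one_smul] at h'
    exact h'
  have hr' : ∀ (V : GrVec k G) (x : G) (v : V), v ∈ V.deg x →
      Hom.lin (S.rightUnitor V).hom (v ⊗ₜ[k] e) = (Units.mk0 _ (hr x) : k) • v := by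
    intro V x v hv
    have h := congrArg (fun f => Hom.lin f ((1 : k) ⊗ₜ[k] e))
      (S.rightUnitor_naturality (simpleHom hv))
    have h' : Hom.lin (S.rightUnitor V).hom (((1 : k) • v) ⊗ₜ[k] e) = _ := h
    rw [one_smul] at h'
    exact h'
  refine ⟨e, heg, he, fun v => exists_smul_eq_of_finrank_eq_one hfin he v, _, _, hl', hr',
    fun x y => ?_⟩
  have key : ∀ (U V : GrVec k G) (a : U) (b : V), a ∈ U.deg x → b ∈ V.deg y →
      ((φ x 0 y * Units.mk0 _ (hl y) : kˣ) : k) • (a ⊗ₜ[k] b) =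
        (Units.mk0 _ (hr x) : k) • (a ⊗ₜ[k] b) := by
    intro U V a b ha hb
    have h := congrArg (fun f => Hom.lin f ((a ⊗ₜ[k] e) ⊗ₜ[k] b)) (S.triangle U V)
    simp only [comp_lin, LinearMap.comp_apply] at h
    rw [hφ _ _ _ _ _ _ _ _ _ ha heg hb, map_smul, tensorHom_lin, tensorHom_lin,
      TensorProduct.map_tmul, TensorProduct.map_tmul, hl' V y b hb, hr' U x a ha, id_lin, id_lin,
      LinearMap.id_apply, LinearMap.id_apply, TensorProduct.tmul_smul, smul_smul,
      ← TensorProduct.smul_tmul', ← Units.val_mul] at h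
    exact h
  have h1 : ((1 : k) ⊗ₜ[k] (1 : k)) ≠ 0 := tmul_ne_zero one_ne_zero one_ne_zero
  exact Units.ext (smul_left_injective k h1
    (key (simple k x) (simple k y) _ _ (one_mem_deg_simple x) (one_mem_deg_simple y)))

end MonoidalStructure

end GrVec

/-! ### The tensor equivalence defined by a 2-cochain -/

namespace GrVec
namespace MonoidalStructure

variable {k : Type u} [Field k] {G : Type w} [DecidableEq G] [AddGroup G] [Fintype G]
  (S : MonoidalStructure k G)

/-- The isomorphism from `k` in degree `0` to the space spanned by a vector of degree `0`. -/
noncomputable def unitIso {I : GrVec k G} {e : I} (he0 : e ∈ I.deg 0) (he : e ≠ 0)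
    (hspan : ∀ v : I, ∃ c : k, c • e = v) : unitObj k G ≅ I := by
  let E : k ≃ₗ[k] I := LinearEquiv.ofBijective (LinearMap.toSpanSingleton k I e)
    ⟨smul_left_injective k he, hspan⟩
  exact
  { hom := simpleHom he0
    inv := ⟨E.symm.toLinearMap, fun g v hv => by
      rw [deg_unitObj]
      split_ifs with hg
      · exact Submodule.mem_top
      · obtain ⟨c, rfl⟩ := hspan v
        -- A vector of degree `g ≠ 0` on this line also has degree `0`, so its projection to degree
        -- `g` is both itself and zero.
        have h1 := proj_of_mem I hv
        rw [proj_of_mem_ne I (Ne.symm hg) ((I.deg 0).smul_mem c he0)] at h1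
        rw [← h1, map_zero]
        exact Submodule.zero_mem _⟩
    hom_inv_id := hom_ext E.symm_comp
    inv_hom_id := hom_ext E.comp_symm }

/-- A monoidal structure is tensor equivalent to the one given by a normalized cocycle that is
cohomologous to its associator. -/
theorem tensorEquivalent_ofCocycle {φ : G → G → G → kˣ} (hφ : ∀ (U V W : GrVec k G) (x y z : G)
    (a : U) (b : V) (c : W), a ∈ U.deg x → b ∈ V.deg y → c ∈ W.deg z →
    Hom.lin (S.assoc U V W).hom ((a ⊗ₜ[k] b) ⊗ₜ[k] c) =
      (φ x y z : k) • (a ⊗ₜ[k] (b ⊗ₜ[k] c))) (Ψ : NormalizedCocycle₃ G kˣ) (h : G → G → kˣ)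
    (hh : ∀ x y z, φ x y z * (h (x + y) z * h x y) = Ψ.toFun x y z * (h y z * h x (y + z))) :
    S.TensorEquivalent (ofCocycle Ψ) := by
  obtain ⟨e, he0, he, hspan, l, r, hl, hr, hlr⟩ := S.exists_unitors hφ
  -- The left side depends only on `y` and the right side only on `x`, so both are one constant. Its
  -- inverse `c₀` rescales the unit vector so that the left and right unit conditions hold together.
  have hhlr : ∀ x y, h 0 y * l y = h x 0 * r x := fun x y => by
    have := hh x 0 y
    rw [Ψ.map_zero_mid, add_zero, zero_add, one_mul, mul_comm (h x y), ← mul_assoc,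
      mul_right_cancel_iff] at this
    rw [← this, ← hlr x y]
    ac_rfl
  set c₀ : kˣ := (h 0 0 * l 0)⁻¹ with hc₀
  have hcl : ∀ y, c₀ * h 0 y * l y = 1 := fun y => by
    rw [mul_assoc, hhlr 0 y, hc₀, hhlr 0 0, inv_mul_cancel]
  have hcr : ∀ x, c₀ * h x 0 * r x = 1 := fun x => by
    rw [mul_assoc, ← hhlr x 0, hc₀, inv_mul_cancel]
  have he0' : (c₀ : k) • e ∈ S.unit.deg 0 := (S.unit.deg 0).smul_mem _ he0
  have he' : (c₀ : k) • e ≠ 0 := smul_ne_zero c₀.ne_zero he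
  have hspan' : ∀ v : S.unit, ∃ c : k, c • ((c₀ : k) • e) = v := fun v => by
    obtain ⟨c, rfl⟩ := hspan v
    exact ⟨c * (c₀⁻¹ : kˣ), by rw [smul_smul, mul_assoc, ← Units.val_mul]; simp⟩
  -- The functor is the identity of `Vec_G`; the tensorator multiplies `U_x ⊗ V_y` by `h x y`, the
  -- unit map sends `1` to `c₀ • e`, and the associativity condition becomes `hh`.
  let F : S.Cat ⥤ (ofCocycle Ψ).Cat := 𝟭 (GrVec k G)
  refine ⟨F, inferInstanceAs (𝟭 (GrVec k G)).IsEquivalence,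
    inferInstanceAs (𝟭 (GrVec k G)).Additive, inferInstanceAs ((𝟭 (GrVec k G)).Linear k), ⟨?_⟩⟩
  refine Functor.CoreMonoidal.toMonoidal
    { εIso := (unitIso he0' he' hspan' : unitObj k G ≅ S.unit)
      μIso := fun U V => (twistIso h U V : tensorObj (k := k) (G := G) U V ≅ tensorObj U V)
      μIso_hom_natural_left := ?_
      μIso_hom_natural_right := ?_
      associativity := ?_
      left_unitality := ?_
      right_unitality := ?_ }
  · intro (U : GrVec k G) (V : GrVec k G) (f : U ⟶ V) (W : GrVec k G)
    exact twistIso_naturality h f (𝟙 W)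
  · intro (U : GrVec k G) (V : GrVec k G) (W : GrVec k G) (f : U ⟶ V)
    exact twistIso_naturality h (𝟙 W) f
  · intro (U : GrVec k G) (V : GrVec k G) (W : GrVec k G)
    refine hom_ext (V := tensorObj (tensorObj U V) W) (W := tensorObj U (tensorObj V W)) <|
      tensor_ext₃ fun x a ha y b hb z c hc => ?_
    change Hom.lin (S.assoc U V W).hom (Hom.lin (twistIso h (tensorObj U V) W).hom
        (Hom.lin (twistIso h U V).hom (a ⊗ₜ[k] b) ⊗ₜ[k] c)) =
      Hom.lin (twistIso h U (tensorObj V W)).hom (Hom.lin (tensorHom (𝟙 U) (twistIso h V W).hom)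
        (Hom.lin (assocIso Ψ.toFun U V W).hom ((a ⊗ₜ[k] b) ⊗ₜ[k] c)))
    have h1 : Hom.lin (tensorHom (𝟙 U) (twistIso h V W).hom) (a ⊗ₜ[k] (b ⊗ₜ[k] c)) =
        (h y z : k) • (a ⊗ₜ[k] (b ⊗ₜ[k] c)) := by
      rw [tensorHom_lin, TensorProduct.map_tmul, twistIso_hom_tmul h hb hc,
        TensorProduct.tmul_smul]
      rfl
    have h2 := twistIso_hom_tmul h (U := tensorObj U V) (tmul_mem_tensorDeg ha hb) hc
    have h3 := twistIso_hom_tmul h (V := tensorObj V W) ha (tmul_mem_tensorDeg hb hc)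
    have h4 := congrArg (Units.val : kˣ → k) (hh x y z)
    simp only [Units.val_mul] at h4
    rw [twistIso_hom_tmul h ha hb, ← TensorProduct.smul_tmul', map_smul, map_smul, h2, map_smul,
      hφ _ _ _ _ _ _ _ _ _ ha hb hc, assocIso_hom_tmul _ ha hb hc, map_smul, map_smul, h1,
      map_smul, h3, smul_smul, smul_smul, smul_smul, smul_smul]
    congr 1
    linear_combination h4
  · intro (V : GrVec k G)
    refine hom_ext (V := tensorObj (unitObj k G) V) (W := V) <| TensorProduct.ext' fun c v => ?_
    change c • v = Hom.lin (S.leftUnitor V).hom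
      (Hom.lin (twistIso h S.unit V).hom ((c • ((c₀ : k) • e)) ⊗ₜ[k] v))
    -- Both sides are linear in `v`, and the scalars are known only on homogeneous vectors.
    revert v
    refine LinearMap.congr_fun (f := LinearMap.lsmul k V c) (g := Hom.lin (S.leftUnitor V).hom ∘ₗ
      Hom.lin (twistIso h S.unit V).hom ∘ₗ TensorProduct.mk k S.unit V (c • ((c₀ : k) • e)))
      (V.lin_ext fun x v hv => ?_)
    change c • v = Hom.lin (S.leftUnitor V).hom
      (Hom.lin (twistIso h S.unit V).hom ((c • ((c₀ : k) • e)) ⊗ₜ[k] v))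
    have h1 := congrArg (Units.val : kˣ → k) (hcl x)
    simp only [Units.val_mul, Units.val_one] at h1
    rw [twistIso_hom_tmul h ((S.unit.deg 0).smul_mem c he0') hv, smul_smul,
      ← TensorProduct.smul_tmul', map_smul, map_smul, hl V x v hv, smul_smul, smul_smul]
    congr 1
    linear_combination -c * h1
  · intro (V : GrVec k G)
    refine hom_ext (V := tensorObj V (unitObj k G)) (W := V) <| TensorProduct.ext' fun v c => ?_
    change c • v = Hom.lin (S.rightUnitor V).hom
      (Hom.lin (twistIso h V S.unit).hom (v ⊗ₜ[k] (c • ((c₀ : k) • e))))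
    revert v
    refine LinearMap.congr_fun (f := LinearMap.lsmul k V c) (g := Hom.lin (S.rightUnitor V).hom ∘ₗ
      Hom.lin (twistIso h V S.unit).hom ∘ₗ
        (TensorProduct.mk k V S.unit).flip (c • ((c₀ : k) • e)))
      (V.lin_ext fun x v hv => ?_)
    change c • v = Hom.lin (S.rightUnitor V).hom
      (Hom.lin (twistIso h V S.unit).hom (v ⊗ₜ[k] (c • ((c₀ : k) • e))))
    have h1 := congrArg (Units.val : kˣ → k) (hcr x)
    simp only [Units.val_mul, Units.val_one] at h1
    rw [twistIso_hom_tmul h hv ((S.unit.deg 0).smul_mem c he0'), smul_smul,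
      TensorProduct.tmul_smul, map_smul, map_smul, hr V x v hv, smul_smul, smul_smul]
    congr 1
    linear_combination -c * h1

end MonoidalStructure
end GrVec

/-! ### The classification over an algebraically closed field -/

theorem theorem4p1 {k : Type u} [Field k] [IsAlgClosed k] [CharZero k] (m n : ℕ) [NeZero m]
    [NeZero n] (ζm ζn : kˣ) (hζm : IsPrimitiveRoot ζm m) (hζn : IsPrimitiveRoot ζn n)
    (S : GrVec.MonoidalStructure k (ZMod m × ZMod n)) :
    ∃ a b d : ℕ, a < m ∧ b < Nat.gcd m n ∧ d < n ∧
      S.TensorEquivalent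
        (GrVec.ofCocycle (cocycleABD m n ζm ζn hζm.pow_eq_one hζn.pow_eq_one a b d)) := by
  -- The group `kˣ` meets the requirements on `A`: it is divisible because `k` is algebraically
  -- closed, and its `N`-torsion is generated by any primitive `N`-th root of unity.
  have hdiv : ∀ n : ℕ, n ≠ 0 → ∀ a : kˣ, ∃ b, b ^ n = a := fun n hn a => by
    obtain ⟨z, hz⟩ := IsAlgClosed.exists_pow_nat_eq (a : k) (Nat.pos_of_ne_zero hn)
    have hz0 : z ≠ 0 := fun h => a.ne_zero (by rw [← hz, h, zero_pow hn])
    exact ⟨Units.mk0 z hz0, Units.ext hz⟩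
  have hroot : ∀ {N : ℕ} [NeZero N] {ζ : kˣ}, IsPrimitiveRoot ζ N →
      ∀ ξ : kˣ, ξ ^ N = 1 → ∃ i : ℕ, ζ ^ i = ξ := fun {N} _ {ζ} hζ ξ hξ => by
    obtain ⟨i, -, hi⟩ := (hζ.map_of_injective (f := Units.coeHom k)
      Units.val_injective).eq_pow_of_pow_eq_one (ξ := (ξ : k))
        (by rw [← Units.val_pow_eq_pow_val, hξ, Units.val_one])
    exact ⟨i, Units.ext hi⟩
  obtain ⟨φ, hφ⟩ := S.exists_assoc_tmul
  obtain ⟨a, b, d, h, ha, hb, hd, hh⟩ := exists_cocycleABD hdiv ζm ζn hζm.pow_eq_one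
    hζn.pow_eq_one (hroot hζm) (hroot hζn) φ (S.assoc_cocycle hφ)
  refine ⟨a, b, d, ha, hb, hd, S.tensorEquivalent_ofCocycle hφ _ h fun x y z => ?_⟩
  rw [hh, coboundary₃, mul_assoc, div_mul_cancel]
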